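/- **Theorem 1 (BP fixed points).** Let $G=(V,E)$ be a finite simple graph with maximum degree $\Delta$, and write $\mathcal N(v)$ for the set of neighbours of $v$. Let $D\ge 1$, and let $\psi=\{T_v\}_{v\in V}$ be a PEPS on $G$ with bond dimension $D$ and physical dimension $d$, i.e. a linear map $T_v:\bigotimes_{n\in\mathcal N(v)}\mathbb C^D\to\mathbb C^d$ for every vertex $v$. Fixing the physical index of $T_v$ to be $p$ and reading the leg $n\in\mathcal N(v)$ as output and the other legs as inputs gives an operator $K^{(v,n)}_p:\bigotimes_{m\in\mathcal N(v)\setminus\{n\}}\mathbb C^D\to\mathbb C^D$; put $\Phi_{(v,n)}(X)=\sum_{p=1}^d K^{(v,n)}_pX(K^{(v,n)}_p)^\dagger$. Let $\mathcal K_G$ be the set of families $\boldsymbol\mu=(\mu_{\vec e})$ of positive semidefinite trace-one $D\times D$ matrices indexed by the directed edges $\vec e$ of $G$, let $\|\boldsymbol\mu\|_{\max}=\max_{\vec e}\|\mu_{\vec e}\|_1$ with $\|\cdot\|_1$ the trace norm, and define the message-passing maps $$f_{(v,n)}(\boldsymbol\mu)=\Phi_{(v,n)}\Big(\bigotimes_{m\in\mathcal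 N(v)\setminus\{n\}}\mu_{(m,v)}\Big),\qquad [\boldsymbol F(\boldsymbol\mu)]_{\vec e}=\frac{f_{\vec e}(\boldsymbol\mu)}{\operatorname{Tr}f_{\vec e}(\boldsymbol\mu)} .$$ The PEPS is *injective* if every $T_v$ is injective. For $\delta\in(0,1]$ it is *$\delta$-injective* if every $T_v$ is injective and the ratio of the largest to the smallest singular value of $T_v$ is at most $1/\delta$; it is *normalized* if the largest singular value of every $T_v$ is $1$. Put $\varepsilon=1-\delta^2$ and $\varepsilon_*=1/(2\Delta-1)$. (i) If $\psi$ is injective, then $\operatorname{Tr}f_{\vec e}(\boldsymbol\mu)>0$ for all $\boldsymbol\mu\in\mathcal K_G$ and all $\vec e$, the map $\boldsymbol F$ sends $\mathcal K_G$ into $\mathcal K_G$, and $\boldsymbol F$ has a fixed point in $\mathcal K_G$. If $\psi$ is moreover normalized and $\delta$-injective, then $\operatorname{Tr}f_{\vec e}(\boldsymbol\mu)\ge D\delta^2$ for all $\boldsymbol\mu\in\mathcal K_G$ and all $\vec e$. (ii) If $\psi$ is $\delta$-injective and $\varepsilon<\varepsilon_*$, then $\boldsymbol F$ is a contraction of $\mathcal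 K_G$: with $q=\frac{2(\Delta-1)\varepsilon}{1-\varepsilon}\in[0,1)$, $$\|\boldsymbol F(\boldsymbol\mu)-\boldsymbol F(\boldsymbol\nu)\|_{\max}\le q\,\|\boldsymbol\mu-\boldsymbol\nu\|_{\max}\qquad(\boldsymbol\mu,\boldsymbol\nu\in\mathcal K_G).$$ Hence $\boldsymbol F$ has a unique fixed point $\boldsymbol\mu_\star$ in $\mathcal K_G$, and for every starting point $\boldsymbol\mu^{(0)}\in\mathcal K_G$ the iterates $\boldsymbol\mu^{(t+1)}=\boldsymbol F(\boldsymbol\mu^{(t)})$ satisfy $\|\boldsymbol\mu^{(t)}-\boldsymbol\mu_\star\|_{\max}\le q^t\|\boldsymbol\mu^{(0)}-\boldsymbol\mu_\star\|_{\max}$ for all $t\ge 0$. If $\varepsilon=0$, then $\boldsymbol\mu^{(t)}=\boldsymbol\mu_\star$ for all $t\ge1$. If $\varepsilon>0$, then $\|\boldsymbol\mu^{(t)}-\boldsymbol\mu_\star\|_{\max}\le\varepsilon'$ for every accuracy $0<\varepsilon'\le\frac12$ and every integer $t\ge C\,\frac{\log(1/\varepsilon')}{\log(\varepsilon_*/\varepsilon)}$,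 where $C>0$ is an absolute constant (independent of the graph, the PEPS, $D$, $d$, $\delta$, $\varepsilon'$ and $\boldsymbol\mu^{(0)}$). -/

import Mathlib

open scoped ComplexOrder

noncomputable section

namespace TNBP

/-- The singular values of a complex matrix `A`, viewed as a linear map between Euclidean spaces:
`sval A 0 ≥ sval A 1 ≥ ⋯ ≥ sval A (k - 1)` where `k` is the number of columns
(and `sval A i = 0` for `i ≥ k`). -/
def sval {m n : Type*} [Fintype m] [Fintype n] [DecidableEq n] (A : Matrix m n ℂ) (i : ℕ) : ℝ :=
  (Matrix.toEuclideanLin A).singularValues i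

/-- The trace norm (Schatten 1-norm) of a matrix: the sum of its singular values. -/
def traceNorm {m n : Type*} [Fintype m] [Fintype n] [DecidableEq n] (A : Matrix m n ℂ) : ℝ :=
  ∑ i ∈ Finset.range (Fintype.card n), sval A i

variable {V : Type*}

/-- A PEPS on the graph `G` with bond dimension `D` and physical dimension `d`: for every vertex
`v` a linear map `⨂_{n ∈ N(v)} ℂ^D → ℂ^d`, given by its matrix in the product basis, which is
indexed by the functions `N(v) → Fin D`. -/
structure PEPS (G : SimpleGraph V) (D d : ℕ) where
  tensor : ∀ v : V, Matrix (Fin d) (G.neighborSet v → Fin D) ℂ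

/-- A family of `D × D` matrices, one for every directed edge `(v, w)` (message from `v` to `w`). -/
abbrev Messages (G : SimpleGraph V) (D : ℕ) : Type _ :=
  G.Dart → Matrix (Fin D) (Fin D) ℂ

/-- The set `K_G` of families of positive semidefinite, trace-one messages. -/
def densityMessages (G : SimpleGraph V) (D : ℕ) : Set (Messages G D) :=
  {μ | ∀ e, (μ e).PosSemidef ∧ (μ e).trace = 1}

/-- `‖μ‖_max`, the maximum over the directed edges of the trace norms (`0` if there is no edge). -/
def maxNorm {G : SimpleGraph V} {D : ℕ} (μ : Messages G D) : ℝ :=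
  ⨆ e, traceNorm (μ e)

/-- The legs at `v` other than `n`, that is, `N(v) \ {n}`. -/
abbrev OtherLegs (G : SimpleGraph V) (v : V) (n : G.neighborSet v) : Type _ :=
  {m : G.neighborSet v // m ≠ n}

/-- The directed edge from the neighbour `m` of `v` to `v`. -/
def inDart (G : SimpleGraph V) (v : V) (m : G.neighborSet v) : G.Dart :=
  ⟨(m.1, v), SimpleGraph.Adj.symm m.2⟩

/-- The head of a directed edge `(v, n)`, as a neighbour of `v`. -/
def outLeg {G : SimpleGraph V} (e : G.Dart) : G.neighborSet e.fst :=
  ⟨e.snd, e.adj⟩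

/-- The tensor product `⨂_i A_i` of a finite family of `D × D` matrices, in the product basis. -/
def tensorProd {ι : Type*} [Fintype ι] {D : ℕ} (A : ι → Matrix (Fin D) (Fin D) ℂ) :
    Matrix (ι → Fin D) (ι → Fin D) ℂ :=
  Matrix.of fun x y => ∏ i, A i (x i) (y i)

namespace PEPS

variable {G : SimpleGraph V} {D d : ℕ}

section
variable [DecidableEq V]

/-- The operator `⨂_{m ∈ N(v) \ {n}} ℂ^D → ℂ^D` obtained from `T_v` by fixing the physical index
to be `p` and reading the leg `n` as output and the other legs as input. -/
def kraus (ψ : PEPS G D d) (v : V) (n : G.neighborSet v) (p : Fin d) :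
    Matrix (Fin D) (OtherLegs G v n → Fin D) ℂ :=
  Matrix.of fun j x => ψ.tensor v p fun m => if h : m = n then j else x ⟨m, h⟩

variable [Fintype V] [DecidableRel G.Adj]

/-- The virtual superoperator `Φ_{(v,n)}` from the legs `N(v) \ {n}` to the leg `n`: the tensor
`T_v` and its complex conjugate, contracted over the physical leg. -/
def superop (ψ : PEPS G D d) (v : V) (n : G.neighborSet v)
    (X : Matrix (OtherLegs G v n → Fin D) (OtherLegs G v n → Fin D) ℂ) :
    Matrix (Fin D) (Fin D) ℂ :=
  ∑ p, ψ.kraus v n p * X * (ψ.kraus v n p).conjTranspose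

/-- The unnormalized message-passing map
`f_{(v,n)}(μ) = Φ_{(v,n)} (⨂_{m ∈ N(v) \ {n}} μ_{(m,v)})`. -/
def unnormalizedMap (ψ : PEPS G D d) (μ : Messages G D) : Messages G D := fun e =>
  ψ.superop e.fst (outLeg e) (tensorProd fun m => μ (inDart G e.fst m.1))

/-- The normalized message-passing map `F(μ)_e = f_e(μ) / Tr f_e(μ)`. -/
def bpMap (ψ : PEPS G D d) (μ : Messages G D) : Messages G D := fun e =>
  (ψ.unnormalizedMap μ e).trace⁻¹ • ψ.unnormalizedMap μ e

end

section
variable [Fintype V] [DecidableEq V] [DecidableRel G.Adj]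

/-- Every local tensor is injective as a map from the virtual to the physical space. -/
def IsInjective (ψ : PEPS G D d) : Prop :=
  ∀ v, Function.Injective (Matrix.toEuclideanLin (ψ.tensor v))

/-- `δ`-injectivity: every local tensor is injective with condition number
`σ_max / σ_min ≤ 1 / δ`. -/
def IsDeltaInjective (ψ : PEPS G D d) (δ : ℝ) : Prop :=
  ψ.IsInjective ∧ ∀ v, ∀ i < Fintype.card (G.neighborSet v → Fin D),
    δ * sval (ψ.tensor v) 0 ≤ sval (ψ.tensor v) i

/-- The largest singular value of every local tensor is `1`. -/
def IsNormalized (ψ : PEPS G D d) : Prop :=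
  ∀ v, sval (ψ.tensor v) 0 = 1

end

end PEPS

end TNBP

end

/-!
A tensor `T` enters the message-passing map only through its Gram matrix `M = Tᴴ * T`: the map
`Φ_{(v,n)}` is contraction of `M` with the environment `X`, the product of the incoming messages,
on all legs but `n` (`TNBP.contract`, `TNBP.PEPS.unnormalizedMap_eq_contract`). This is positive
and additive in `M` and in `X`, and contraction with a scalar matrix `c` gives `c * tr X` times the
identity. Injectivity says `M ≥ c` for some `c > 0`, so that `tr f ≥ c * D > 0`
(`TNBP.le_trace_contract`), and the normalized map `F` is a continuous self-map of the compact
convex set of density messages. It has a fixed point by Brouwer's theorem.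

For the contraction, let `σ` be the largest singular value, so `(δ * σ) ^ 2 ≤ M ≤ σ ^ 2`. Write
`M = σ ^ 2 - E`. The scalar part does not distinguish two environments of trace one, hence the
difference of the outputs is that of the contractions with `E`, and `0 ≤ E ≤ ε * σ ^ 2` bounds
its trace norm by `ε * σ ^ 2 * D` times that of the difference of the environments. Normalization
costs a factor `2` and division by a trace that is at least `(1 - ε) * σ ^ 2 * D`
(`TNBP.traceNorm_normalized_contract_sub_le`); telescoping over the at most `Δ - 1` incoming
messages (`TNBP.exists_tensorProd_sub`) gives `q = 2 (Δ - 1) ε / (1 - ε)`. The trace norm is used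
only through decompositions `A = P - N` into positive matrices: the least value of `tr P + tr N`
is the trace norm of `A` (`TNBP.traceNorm_sub_le`, `TNBP.exists_posSemidef_sub`). Finally
`q ≤ ε / ε_*` and the diameter `2` of the set of messages yield the number of steps.

Brouwer's theorem is proved by the analytic argument of Milnor and Rogers. If `r` were a `C¹`
retraction of the ball onto the sphere, `x ↦ x + t • (r x - x)` would permute the ball for small
`t`, so the integral of its Jacobian, a polynomial in `t`, would be constant; at `t = 1` it
vanishes. Smooth approximation and the nearest-point projection then give the theorem for
continuous maps of compact convex sets.
-/

/-! ### Brouwer's fixed point theorem -/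

/-- `det (1 + A)` is a fixed linear combination, with weights of sum `1`, of the values
`det (1 + t • A)` at arbitrarily small positive `t`: these values are a polynomial in `t` of degree
at most the dimension, and the weights are those of Lagrange interpolation. -/
theorem exists_weights_det_one_add (n : ℕ) {τ : ℝ} (hτ : 0 < τ) :
    ∃ t w : Fin (n + 1) → ℝ, (∀ i, 0 < t i ∧ t i < τ) ∧ ∑ i, w i = 1 ∧
      ∀ A : EuclideanSpace ℝ (Fin n) →L[ℝ] EuclideanSpace ℝ (Fin n),
        (1 + A).det = ∑ i, w i * (1 + t i • A).det := by
  classical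
  set t : Fin (n + 1) → ℝ := fun i => τ * ((i : ℝ) + 1) / (n + 2) with ht
  have hinj : Function.Injective t := by
    intro i j hij
    have h2 : (n + 2 : ℝ) ≠ 0 := by positivity
    simp only [ht] at hij
    rw [div_left_inj' h2] at hij
    have := mul_left_cancel₀ hτ.ne' hij
    exact Fin.ext (by exact_mod_cast add_right_cancel this)
  refine ⟨t, fun i => (Lagrange.basis Finset.univ t i).eval 1, fun i => ⟨by positivity, ?_⟩, ?_, ?_⟩
  · rw [ht, div_lt_iff₀ (by positivity)]
    have : (i : ℝ) + 1 < n + 2 := by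
      have := i.2
      exact_mod_cast (by omega : (i : ℕ) + 1 < n + 2)
    exact mul_lt_mul_of_pos_left this hτ
  · rw [← Polynomial.eval_finsetSum, Lagrange.sum_basis hinj.injOn Finset.univ_nonempty]
    simp
  · intro A
    let b := (EuclideanSpace.basisFun (Fin n) ℝ).toBasis
    set M : Matrix (Fin n) (Fin n) ℝ := LinearMap.toMatrix b b A with hM
    set p : Polynomial ℝ := ((Polynomial.X : Polynomial ℝ) • M.map Polynomial.C
      + (1 : Matrix (Fin n) (Fin n) ℝ).map Polynomial.C).det with hp
    have hev : ∀ s : ℝ, p.eval s = (1 + s • A).det := by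
      intro s
      have h1 : (1 + s • A).det = (1 + s • M).det := by
        rw [ContinuousLinearMap.det, ← LinearMap.det_toMatrix b]
        congr 1
        simp [hM, LinearMap.toMatrix_one]
      rw [h1, hp, ← Polynomial.coe_evalRingHom, RingHom.map_det]
      congr 1
      ext i j
      simp only [Polynomial.coe_evalRingHom, RingHom.mapMatrix_apply, Matrix.map_apply,
        Matrix.add_apply, Matrix.smul_apply, smul_eq_mul, Polynomial.eval_add, Polynomial.eval_mul,
        Polynomial.eval_X, Polynomial.eval_C]
      exact add_comm _ _
    have hdeg : p.degree < (Finset.univ : Finset (Fin (n + 1))).card := by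
      refine lt_of_le_of_lt Polynomial.degree_le_natDegree ?_
      have := Polynomial.natDegree_det_X_add_C_le M 1
      simp only [Fintype.card_fin, Finset.card_univ] at this ⊢
      exact_mod_cast Nat.lt_succ_of_le this
    have := Lagrange.eq_interpolate hinj.injOn hdeg
    have h1 : p.eval 1 = _ := congrArg (Polynomial.eval 1) this
    rw [Lagrange.interpolate_apply, Polynomial.eval_finsetSum] at h1
    simp only [Polynomial.eval_mul, Polynomial.eval_C, hev, one_smul] at h1
    rw [h1]
    exact Finset.sum_congr rfl fun i _ => mul_comm _ _

open MeasureTheory Metric in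
/-- If `h` is a Lipschitz displacement vanishing off the open unit ball, then `x ↦ x + t • h x`
permutes the unit ball for small `t`, so `∫ det (1 + t • h')` is the volume of the ball for
these `t`, hence for `t = 1`. -/
theorem integral_det_one_add_eq_volume {n : ℕ}
    {h : EuclideanSpace ℝ (Fin n) → EuclideanSpace ℝ (Fin n)}
    {h' : EuclideanSpace ℝ (Fin n) → EuclideanSpace ℝ (Fin n) →L[ℝ] EuclideanSpace ℝ (Fin n)}
    {L : NNReal} (hL : LipschitzWith L h)
    (h0 : ∀ x ∉ ball (0 : EuclideanSpace ℝ (Fin n)) 1, h x = 0)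
    (hd : ∀ x ∈ ball (0 : EuclideanSpace ℝ (Fin n)) 1, HasFDerivAt h (h' x) x)
    (hc : ContinuousOn h' (closedBall 0 1)) :
    ∫ x in ball (0 : EuclideanSpace ℝ (Fin n)) 1, (1 + h' x).det =
      volume.real (ball (0 : EuclideanSpace ℝ (Fin n)) 1) := by
  set B := ball (0 : EuclideanSpace ℝ (Fin n)) 1 with hB
  obtain ⟨M, hM⟩ :=
    (isCompact_closedBall (0 : EuclideanSpace ℝ (Fin n)) 1).exists_bound_of_continuousOn hc
  have hM0 : 0 ≤ M := (norm_nonneg _).trans (hM 0 (by simp))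
  -- near the identity the determinant is positive
  obtain ⟨δ, hδ, hdet⟩ : ∃ δ > 0, ∀ A : EuclideanSpace ℝ (Fin n) →L[ℝ] EuclideanSpace ℝ (Fin n),
      ‖A‖ < δ → 0 < (1 + A).det := by
    have hcont : Continuous fun A : EuclideanSpace ℝ (Fin n) →L[ℝ] EuclideanSpace ℝ (Fin n) =>
      (1 + A).det := ContinuousLinearMap.continuous_det.comp (continuous_const.add continuous_id)
    have : ∀ᶠ A in nhds (0 : EuclideanSpace ℝ (Fin n) →L[ℝ] EuclideanSpace ℝ (Fin n)),
        0 < (1 + A).det := by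
      refine hcont.continuousAt.eventually (lt_mem_nhds ?_)
      simp [ContinuousLinearMap.det]
    obtain ⟨δ, hδ, H⟩ := Metric.eventually_nhds_iff.1 this
    exact ⟨δ, hδ, fun A hA => H (by simpa using hA)⟩
  set τ : ℝ := min (δ / (M + 1)) (1 / (L + 1)) with hτdef
  have hτ : 0 < τ := by positivity
  have key : ∀ t : ℝ, 0 < t → t < τ → ∫ x in B, (1 + t • h' x).det = volume.real B := by
    intro t ht htτ
    have ht1 : t * M < δ := by
      have := htτ.trans_le (min_le_left _ _)
      rw [lt_div_iff₀ (by positivity)] at this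
      nlinarith
    have ht2 : t * L < 1 := by
      have := htτ.trans_le (min_le_right _ _)
      rw [lt_div_iff₀ (by positivity)] at this
      nlinarith
    set g : EuclideanSpace ℝ (Fin n) → EuclideanSpace ℝ (Fin n) := fun x => x + t • h x with hg
    have hinj : Function.Injective g := by
      intro x y hxy
      by_contra hne
      have h1 : x - y = t • (h y - h x) := by
        simp only [hg] at hxy
        rw [smul_sub, sub_eq_sub_iff_add_eq_add, hxy, add_comm]
      have h2 : ‖x - y‖ ≤ t * L * ‖x - y‖ := by
        conv_lhs => rw [h1, norm_smul, Real.norm_of_nonneg ht.le]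
        have := hL.dist_le_mul y x
        rw [dist_eq_norm, dist_eq_norm, norm_sub_rev y x] at this
        rw [mul_assoc]
        exact mul_le_mul_of_nonneg_left this ht.le
      have h3 : 0 < ‖x - y‖ := norm_pos_iff.2 (sub_ne_zero.2 hne)
      nlinarith
    have hsurj : Function.Surjective g := by
      intro y
      have hK : ContractingWith (⟨t, ht.le⟩ * L) fun x => y - t • h x := by
        refine ⟨by exact_mod_cast ht2, LipschitzWith.of_dist_le_mul fun a b => ?_⟩
        have := hL.dist_le_mul a b
        rw [dist_eq_norm] at this ⊢
        rw [show y - t • h a - (y - t • h b) = -(t • (h a - h b)) by rw [smul_sub]; abel, norm_neg,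
          norm_smul, Real.norm_of_nonneg ht.le]
        calc t * ‖h a - h b‖ ≤ t * (L * dist a b) := mul_le_mul_of_nonneg_left this ht.le
          _ = _ := by rw [← mul_assoc]; rfl
      refine ⟨ContractingWith.fixedPoint _ hK, ?_⟩
      have := hK.fixedPoint_isFixedPt
      rw [Function.IsFixedPt] at this
      simp only [hg]
      nth_rewrite 1 [← this]
      simp
    have hout : ∀ x ∉ B, g x = x := fun x hx => by simp [hg, h0 x hx]
    have himg : g '' B = B := by
      apply Set.Subset.antisymm
      · rintro _ ⟨x, hx, rfl⟩
        by_contra hgx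
        exact hgx (by rwa [hinj (hout _ hgx)])
      · intro y hy
        obtain ⟨x, rfl⟩ := hsurj y
        refine ⟨x, ?_, rfl⟩
        by_contra hx
        exact hx (by rwa [hout x hx] at hy)
    have hcv := integral_image_eq_integral_abs_det_fderiv_smul volume (s := B) (f := g)
      (f' := fun x => 1 + t • h' x) measurableSet_ball
      (fun x hx => ((hasFDerivAt_id x).add ((hd x hx).const_smul t)).hasFDerivWithinAt)
      hinj.injOn (fun _ => (1 : ℝ))
    rw [himg] at hcv
    simp only [smul_eq_mul, mul_one, integral_const, MeasurableSet.univ, measureReal_restrict_apply,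
      Set.univ_inter] at hcv
    rw [hcv]
    refine setIntegral_congr_fun measurableSet_ball fun x hx => ?_
    refine (abs_of_pos (hdet _ ?_)).symm
    rw [norm_smul, Real.norm_of_nonneg ht.le]
    exact (mul_le_mul_of_nonneg_left (hM x (ball_subset_closedBall hx)) ht.le).trans_lt ht1
  obtain ⟨t, w, ht, hw, hdetw⟩ := exists_weights_det_one_add n hτ
  have hint : ∀ i, IntegrableOn (fun x => w i * (1 + t i • h' x).det) B := by
    intro i
    refine IntegrableOn.mono_set ?_ (ball_subset_closedBall (x := 0) (ε := 1))
    refine ContinuousOn.integrableOn_compact (isCompact_closedBall _ _) ?_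
    refine continuousOn_const.mul (ContinuousLinearMap.continuous_det.comp_continuousOn ?_)
    exact continuousOn_const.add (hc.const_smul (t i))
  rw [setIntegral_congr_fun measurableSet_ball fun x _ => hdetw (h' x)]
  rw [integral_finsetSum _ fun i _ => hint i]
  simp_rw [integral_const_mul, fun i => key (t i) (ht i).1 (ht i).2]
  rw [← Finset.sum_mul, hw, one_mul]

open MeasureTheory Metric in
/-- There is no `C¹` retraction of the closed unit ball onto the sphere. -/
theorem not_exists_contDiff_retraction {n : ℕ}
    {r : EuclideanSpace ℝ (Fin n) → EuclideanSpace ℝ (Fin n)}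
    (hr : ∀ x ∈ closedBall (0 : EuclideanSpace ℝ (Fin n)) 1, ContDiffAt ℝ 1 r x)
    (hr1 : ∀ x ∈ closedBall (0 : EuclideanSpace ℝ (Fin n)) 1, ‖r x‖ = 1)
    (hrs : ∀ x ∈ sphere (0 : EuclideanSpace ℝ (Fin n)) 1, r x = x) : False := by
  classical
  set B := ball (0 : EuclideanSpace ℝ (Fin n)) 1 with hB
  set h : EuclideanSpace ℝ (Fin n) → EuclideanSpace ℝ (Fin n) :=
    fun x => if x ∈ B then r x - x else 0 with hh
  set h' : EuclideanSpace ℝ (Fin n) → EuclideanSpace ℝ (Fin n) →L[ℝ] EuclideanSpace ℝ (Fin n) :=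
    fun x => fderiv ℝ r x - 1 with hh'
  have hdiff : ∀ x ∈ closedBall (0 : EuclideanSpace ℝ (Fin n)) 1,
      HasFDerivAt (fun x => r x - x) (h' x) x := fun x hx =>
    ((hr x hx).differentiableAt one_ne_zero).hasFDerivAt.sub (hasFDerivAt_id x)
  have hc : ContinuousOn h' (closedBall 0 1) := fun x hx =>
    (((hr x hx).fderiv_right (m := 0) (by simp)).continuousAt.sub
      continuousAt_const).continuousWithinAt
  have heq : ∀ x ∈ closedBall (0 : EuclideanSpace ℝ (Fin n)) 1, h x = r x - x := by
    intro x hx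
    by_cases hxB : x ∈ B
    · simp [hh, hxB]
    · have : x ∈ sphere (0 : EuclideanSpace ℝ (Fin n)) 1 := by
        simp only [hB, mem_ball_zero_iff, not_lt, mem_closedBall_zero_iff, mem_sphere_zero_iff_norm]
          at hxB hx ⊢
        exact le_antisymm hx hxB
      simp [hh, hxB, hrs x this]
  have h0 : ∀ x ∉ B, h x = 0 := fun x hx => by simp [hh, hx]
  obtain ⟨M, hM⟩ :=
    (isCompact_closedBall (0 : EuclideanSpace ℝ (Fin n)) 1).exists_bound_of_continuousOn hc
  have hM0 : 0 ≤ M := (norm_nonneg _).trans (hM 0 (by simp))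
  have hLip : ∀ x ∈ closedBall (0 : EuclideanSpace ℝ (Fin n)) 1,
      ∀ y ∈ closedBall (0 : EuclideanSpace ℝ (Fin n)) 1, ‖h x - h y‖ ≤ M * ‖x - y‖ := by
    intro x hx y hy
    rw [heq x hx, heq y hy]
    have hconv := convex_closedBall (0 : EuclideanSpace ℝ (Fin n)) 1
    exact hconv.norm_image_sub_le_of_norm_hasFDerivWithin_le
      (fun z hz => (hdiff z hz).hasFDerivWithinAt) hM hy hx
  -- a segment leaving the ball crosses the sphere, where `h` vanishes
  have hcross : ∀ x ∈ closedBall (0 : EuclideanSpace ℝ (Fin n)) 1,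
      ∀ y ∉ closedBall (0 : EuclideanSpace ℝ (Fin n)) 1, ‖h x - h y‖ ≤ M * ‖x - y‖ := by
    intro x hx y hy
    obtain ⟨s, hs, hs1⟩ : ∃ s ∈ Set.Icc (0 : ℝ) 1, ‖x + s • (y - x)‖ = 1 := by
      have hcs : ContinuousOn (fun s : ℝ => ‖x + s • (y - x)‖) (Set.Icc 0 1) := by fun_prop
      refine intermediate_value_Icc zero_le_one hcs ⟨by simpa using hx, ?_⟩
      simpa using (not_le.1 (by simpa using hy) : 1 < ‖y‖).le
    set z := x + s • (y - x) with hz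
    have hzB : z ∉ B := by simp [hB, hs1]
    have hyB : y ∉ B := fun hyB => hy (ball_subset_closedBall hyB)
    have := hLip x hx z (by simp [hs1])
    rw [h0 z hzB] at this
    rw [h0 y hyB]
    refine this.trans (mul_le_mul_of_nonneg_left ?_ hM0)
    rw [hz, sub_add_cancel_left, norm_neg, norm_smul, Real.norm_of_nonneg hs.1, norm_sub_rev y x]
    exact mul_le_of_le_one_left (norm_nonneg _) hs.2
  have hL : LipschitzWith ⟨M, hM0⟩ h := by
    refine LipschitzWith.of_dist_le_mul fun x y => ?_
    rw [dist_eq_norm, dist_eq_norm]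
    change _ ≤ M * _
    by_cases hx : x ∈ closedBall (0 : EuclideanSpace ℝ (Fin n)) 1 <;>
      by_cases hy : y ∈ closedBall (0 : EuclideanSpace ℝ (Fin n)) 1
    · exact hLip x hx y hy
    · exact hcross x hx y hy
    · rw [norm_sub_rev, norm_sub_rev x]
      exact hcross y hy x hx
    · rw [h0 x fun hxB => hx (ball_subset_closedBall hxB),
        h0 y fun hyB => hy (ball_subset_closedBall hyB)]
      simpa using mul_nonneg hM0 (norm_nonneg _)
  have hd : ∀ x ∈ B, HasFDerivAt h (h' x) x := fun x hx =>
    (hdiff x (ball_subset_closedBall hx)).congr_of_eventuallyEq <|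
      (isOpen_ball.mem_nhds hx : B ∈ nhds x) |> fun hm => by
        filter_upwards [hm] with y hy using heq y (ball_subset_closedBall hy)
  have hvol := integral_det_one_add_eq_volume hL h0 hd hc
  have hzero : ∫ x in B, (1 + h' x).det = 0 := by
    refine (setIntegral_congr_fun measurableSet_ball fun x hx => ?_).trans (integral_zero' _ _)
    -- differentiating `‖r‖² = 1` shows that the range of `r'` is orthogonal to `r`
    have hrd : HasFDerivAt r (fderiv ℝ r x) x :=
      ((hr x (ball_subset_closedBall hx)).differentiableAt one_ne_zero).hasFDerivAt
    have hconst : HasFDerivAt (fun y => ‖r y‖ ^ 2)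
        (0 : EuclideanSpace ℝ (Fin n) →L[ℝ] ℝ) x := by
      refine (hasFDerivAt_const (1 : ℝ) x).congr_of_eventuallyEq ?_
      filter_upwards [isOpen_ball.mem_nhds hx] with y hy
      rw [hr1 y (ball_subset_closedBall hy), one_pow]
    have horth := hrd.norm_sq.unique hconst
    have hsimp : (1 + h' x) = fderiv ℝ r x := by simp [hh']
    simp only [hsimp, Pi.zero_apply]
    by_contra hne
    have hunit : IsUnit (LinearMap.det (fderiv ℝ r x : EuclideanSpace ℝ (Fin n) →ₗ[ℝ] _)) :=
      isUnit_iff_ne_zero.2 hne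
    obtain ⟨v, hv⟩ := (LinearMap.equivOfIsUnitDet hunit).surjective (r x)
    have hv' : fderiv ℝ r x v = r x := by
      rwa [← LinearEquiv.coe_coe, LinearMap.coe_equivOfIsUnitDet] at hv
    have := congrArg (fun φ => φ v) horth
    simp [hv', hr1 x (ball_subset_closedBall hx)] at this
  rw [hzero] at hvol
  have : 0 < volume.real (ball (0 : EuclideanSpace ℝ (Fin n)) 1) :=
    ENNReal.toReal_pos (measure_ball_pos _ _ one_pos).ne' measure_ball_lt_top.ne
  exact this.ne hvol

open Metric in
/-- A `C¹` self-map of the closed unit ball has a fixed point: otherwise the points where the ray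
from `f x` through `x` leaves the ball would give a `C¹` retraction onto the sphere. -/
theorem exists_fixedPoint_of_contDiff {n : ℕ}
    {f : EuclideanSpace ℝ (Fin n) → EuclideanSpace ℝ (Fin n)} (hf : ContDiff ℝ 1 f)
    (hmaps : ∀ x ∈ closedBall (0 : EuclideanSpace ℝ (Fin n)) 1, ‖f x‖ ≤ 1) :
    ∃ x ∈ closedBall (0 : EuclideanSpace ℝ (Fin n)) 1, f x = x := by
  by_contra! hne
  -- `r x = x + s x • u x` with `s x` the larger root of `a s² + 2 b s + ‖x‖² - 1`; its reduced
  -- discriminant `Δ` is positive on the closed ball, and `s = 0` on the sphere as `b > 0` there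
  set u : EuclideanSpace ℝ (Fin n) → EuclideanSpace ℝ (Fin n) := fun x => x - f x with hu
  set a : EuclideanSpace ℝ (Fin n) → ℝ := fun x => ‖u x‖ ^ 2 with ha
  set b : EuclideanSpace ℝ (Fin n) → ℝ := fun x => inner ℝ x (u x) with hb
  set Δ : EuclideanSpace ℝ (Fin n) → ℝ := fun x => b x ^ 2 + a x * (1 - ‖x‖ ^ 2) with hΔ
  have huC : ContDiff ℝ 1 u := contDiff_id.sub hf
  have haC : ContDiff ℝ 1 a := huC.norm_sq ℝ
  have hbC : ContDiff ℝ 1 b := contDiff_id.inner ℝ huC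
  have hΔC : ContDiff ℝ 1 Δ := (hbC.pow 2).add (haC.mul (contDiff_const.sub (contDiff_norm_sq ℝ)))
  have ha0 : ∀ x ∈ closedBall (0 : EuclideanSpace ℝ (Fin n)) 1, 0 < a x := fun x hx =>
    pow_pos (norm_pos_iff.2 (sub_ne_zero.2 (hne x hx).symm)) 2
  have hbs : ∀ x ∈ sphere (0 : EuclideanSpace ℝ (Fin n)) 1, 0 < b x := by
    intro x hx
    have hxB := sphere_subset_closedBall hx
    have hx1 : ‖x‖ = 1 := by simpa using hx
    have h1 : a x = ‖x‖ ^ 2 - 2 * inner ℝ x (f x) + ‖f x‖ ^ 2 := norm_sub_sq_real x (f x)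
    have h2 : b x = ‖x‖ ^ 2 - inner ℝ x (f x) := by
      simp only [hb, hu, inner_sub_right, real_inner_self_eq_norm_sq]
    have h3 := ha0 x hxB
    have h4 := hmaps x hxB
    have h5 : ‖f x‖ ^ 2 ≤ 1 := pow_le_one₀ (norm_nonneg _) h4
    rw [hx1] at h1 h2
    linarith
  have hΔ0 : ∀ x ∈ closedBall (0 : EuclideanSpace ℝ (Fin n)) 1, 0 < Δ x := by
    intro x hx
    have hx1 : ‖x‖ ≤ 1 := by simpa using hx
    rcases hx1.lt_or_eq with h | h
    · have : ‖x‖ ^ 2 < 1 := pow_lt_one₀ (norm_nonneg _) h two_ne_zero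
      have := mul_pos (ha0 x hx) (sub_pos.2 this)
      have := sq_nonneg (b x)
      simp only [hΔ]
      linarith
    · have := pow_pos (hbs x (by simpa using h)) 2
      simp only [hΔ, h]
      linarith
  set s : EuclideanSpace ℝ (Fin n) → ℝ := fun x => (-b x + √(Δ x)) / a x with hs
  refine not_exists_contDiff_retraction (r := fun x => x + s x • u x) ?_ ?_ ?_
  · intro x hx
    have hsC : ContDiffAt ℝ 1 s x :=
      (hbC.contDiffAt.neg.add (hΔC.contDiffAt.sqrt (hΔ0 x hx).ne')).div haC.contDiffAt
      (ha0 x hx).ne'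
    exact contDiffAt_id.add (hsC.smul huC.contDiffAt)
  · intro x hx
    have h1 : ‖x + s x • u x‖ ^ 2 = ‖x‖ ^ 2 + 2 * (s x * b x) + s x ^ 2 * a x := by
      rw [norm_add_sq_real, inner_smul_right, norm_smul, mul_pow, Real.norm_eq_abs, sq_abs]
    have h2 : a x * s x = -b x + √(Δ x) := mul_div_cancel₀ _ (ha0 x hx).ne'
    have h3 : √(Δ x) ^ 2 = b x ^ 2 + a x * (1 - ‖x‖ ^ 2) := Real.sq_sqrt (hΔ0 x hx).le
    have h4 : a x * ‖x + s x • u x‖ ^ 2 = a x * 1 := by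
      have h5 : (a x * s x + b x) ^ 2 = b x ^ 2 + a x * (1 - ‖x‖ ^ 2) := by
        rw [← h3, h2]; ring
      rw [h1]
      linear_combination h5
    have h6 := mul_left_cancel₀ (ha0 x hx).ne' h4
    exact (pow_eq_one_iff_of_nonneg (norm_nonneg _) two_ne_zero).1 h6
  · intro x hx
    have hx1 : ‖x‖ = 1 := by simpa using hx
    have : s x = 0 := by
      simp only [hs, hΔ, hx1]
      rw [one_pow, sub_self, mul_zero, add_zero, Real.sqrt_sq (hbs x hx).le]
      simp
    simp [this]

/-- The nearest-point projection onto a nonempty compact convex set, as a continuous retraction. -/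
theorem exists_continuous_retraction {n : ℕ} {K : Set (EuclideanSpace ℝ (Fin n))}
    (hK : IsCompact K) (hconv : Convex ℝ K) (hne : K.Nonempty) :
    ∃ P : EuclideanSpace ℝ (Fin n) → EuclideanSpace ℝ (Fin n),
      Continuous P ∧ (∀ x, P x ∈ K) ∧ ∀ x ∈ K, P x = x := by
  choose P hPK hP using exists_norm_eq_iInf_of_complete_convex hne hK.isComplete hconv
  have hin : ∀ x, ∀ w ∈ K, inner ℝ (x - P x) (w - P x) ≤ 0 := fun x =>
    (norm_eq_iInf_iff_real_inner_le_zero hconv (hPK x)).1 (hP x)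
  refine ⟨P, ?_, hPK, fun x hx => ?_⟩
  · refine (LipschitzWith.of_dist_le_mul (K := 1) fun x y => ?_).continuous
    rw [dist_eq_norm, dist_eq_norm, NNReal.coe_one, one_mul]
    have h1 := hin x (P y) (hPK y)
    have h2 := hin y (P x) (hPK x)
    have h3 : ‖P x - P y‖ ^ 2 ≤ inner ℝ (x - y) (P x - P y) := by
      rw [← real_inner_self_eq_norm_sq]
      simp only [inner_sub_left, inner_sub_right] at h1 h2 ⊢
      linarith
    have h4 := h3.trans (real_inner_le_norm _ _)
    by_contra! hlt
    nlinarith [norm_nonneg (x - y)]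
  · have := hin x x hx
    rw [real_inner_self_eq_norm_sq] at this
    have h0 : ‖x - P x‖ = 0 := by
      have := le_antisymm this (sq_nonneg _)
      exact pow_eq_zero_iff two_ne_zero |>.1 this
    exact (sub_eq_zero.1 (norm_eq_zero.1 h0)).symm

open Metric in
theorem exists_fixedPoint_euclideanSpace {n : ℕ} {K : Set (EuclideanSpace ℝ (Fin n))}
    (hK : IsCompact K) (hconv : Convex ℝ K) (hne : K.Nonempty)
    {f : EuclideanSpace ℝ (Fin n) → EuclideanSpace ℝ (Fin n)} (hf : ContinuousOn f K)
    (hmaps : Set.MapsTo f K K) : ∃ x ∈ K, f x = x := by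
  by_contra! hfix
  obtain ⟨P, hPc, hPK, hPid⟩ := exists_continuous_retraction hK hconv hne
  -- `f ∘ P` extends `f` to the whole space and has values in `K`, so it has no fixed point either;
  -- a smooth map closer to it than its displacement `c` would have none on a large ball
  set φ := fun x => f (P x) with hφ
  have hφc : Continuous φ := hf.comp_continuous hPc hPK
  have hφK : ∀ x, φ x ∈ K := fun x => hmaps (hPK x)
  have hφne : ∀ x, x ≠ φ x := by
    intro x hx
    have hxK : x ∈ K := hx ▸ hφK x
    exact hfix x hxK (by rw [hφ] at hx; simpa [hPid x hxK] using hx.symm)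
  obtain ⟨R, hR0, hR⟩ : ∃ R : ℝ, 0 < R ∧ ∀ x ∈ K, ‖x‖ ≤ R := by
    obtain ⟨R, hR⟩ := hK.isBounded.exists_norm_le
    exact ⟨max R 1, by positivity, fun x hx => (hR x hx).trans (le_max_left _ _)⟩
  obtain ⟨c, hc0, hc⟩ : ∃ c : ℝ, 0 < c ∧
      ∀ x ∈ closedBall (0 : EuclideanSpace ℝ (Fin n)) (2 * R), c ≤ ‖x - φ x‖ := by
    obtain ⟨x, -, hx⟩ :=
      (isCompact_closedBall (0 : EuclideanSpace ℝ (Fin n)) (2 * R)).exists_isMinOn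
      ⟨0, by simp [hR0.le]⟩ (continuous_id.sub hφc).norm.continuousOn
    exact ⟨‖x - φ x‖, norm_pos_iff.2 (sub_ne_zero.2 (hφne x)), fun y hy => hx hy⟩
  obtain ⟨g, hg, hgφ, -⟩ := hφc.exists_contDiff_approx 1 (ε := fun _ => min c R)
    continuous_const (fun _ => lt_min hc0 hR0)
  have hgR : ∀ x, ‖g x‖ ≤ 2 * R := by
    intro x
    have h1 := (hgφ x).le.trans (min_le_right c R)
    rw [dist_eq_norm] at h1
    have h2 := norm_add_le (g x - φ x) (φ x)
    rw [sub_add_cancel] at h2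
    linarith [hR _ (hφK x)]
  have h2R : 0 < 2 * R := by positivity
  obtain ⟨x, hx, hgx⟩ := exists_fixedPoint_of_contDiff
    (f := fun x => (2 * R)⁻¹ • g ((2 * R) • x))
    ((hg.comp (contDiff_id.const_smul _)).const_smul _) (by
      intro x _
      rw [norm_smul, norm_inv, Real.norm_of_nonneg h2R.le, inv_mul_le_iff₀ h2R, mul_one]
      exact hgR _)
  have hgx' : g ((2 * R) • x) = (2 * R) • x := by
    nth_rewrite 2 [← hgx]
    rw [smul_smul, mul_inv_cancel₀ h2R.ne', one_smul]
  have h1 := hc ((2 * R) • x) (by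
    rw [mem_closedBall_zero_iff] at hx ⊢
    rw [norm_smul, Real.norm_of_nonneg h2R.le]
    exact mul_le_of_le_one_right h2R.le hx)
  have h2 := (hgφ ((2 * R) • x)).trans_le (min_le_left c R)
  rw [hgx', dist_eq_norm] at h2
  exact absurd h1 (not_le.2 h2)

/-- **Brouwer's fixed point theorem** for compact convex sets in finite-dimensional spaces. -/
theorem exists_fixedPoint_of_isCompact_convex {E : Type*} [AddCommGroup E] [Module ℝ E]
    [TopologicalSpace E] [IsTopologicalAddGroup E] [ContinuousSMul ℝ E] [T2Space E]
    [FiniteDimensional ℝ E] {K : Set E} (hK : IsCompact K) (hconv : Convex ℝ K) (hne : K.Nonempty)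
    {f : E → E} (hf : ContinuousOn f K) (hmaps : Set.MapsTo f K K) : ∃ x ∈ K, f x = x := by
  let e := toEuclidean (E := E)
  obtain ⟨_, ⟨x, hx, rfl⟩, hfx⟩ := exists_fixedPoint_euclideanSpace (K := e '' K)
    (hK.image e.continuous) (hconv.is_linear_image ⟨map_add e, map_smul e⟩) (hne.image _)
    (f := fun y => e (f (e.symm y)))
    (e.continuous.comp_continuousOn (hf.comp e.symm.continuous.continuousOn (by
      rintro _ ⟨x, hx, rfl⟩
      simpa using hx)))
    (by
      rintro _ ⟨x, hx, rfl⟩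
      exact ⟨f x, hmaps hx, by simp⟩)
  exact ⟨x, hx, by simpa using hfx⟩

namespace TNBP

open Matrix

/-! ### Trace norm and singular values -/

theorem trace_re_nonneg {n : Type*} [Fintype n] {P : Matrix n n ℂ} (hP : P.PosSemidef) :
    0 ≤ P.trace.re :=
  (Complex.le_def.1 hP.trace_nonneg).1

theorem ofReal_trace_re {n : Type*} [Fintype n] {P : Matrix n n ℂ} (hP : P.PosSemidef) :
    (P.trace.re : ℂ) = P.trace :=
  Complex.ext rfl (Complex.le_def.1 hP.trace_nonneg).2

theorem exists_eq_conjTranspose_mul_self {n : Type*} [Fintype n] [DecidableEq n]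
    {A : Matrix n n ℂ} (hA : A.PosSemidef) : ∃ B : Matrix n n ℂ, A = Bᴴ * B := by
  open scoped MatrixOrder in
  exact CStarAlgebra.nonneg_iff_eq_star_mul_self.1 hA.nonneg

section TraceNorm

variable {m n : Type*} [Fintype m] [Fintype n] [DecidableEq n]

theorem adjoint_comp_toEuclideanLin (A : Matrix m n ℂ) :
    (toEuclideanLin A).adjoint ∘ₗ toEuclideanLin A = toEuclideanLin (Aᴴ * A) := by
  classical
  rw [← Matrix.toEuclideanLin_conjTranspose_eq_adjoint]
  refine LinearMap.ext fun x => ?_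
  simp [toLpLin_apply]

/-- The squared singular values of `A` are the eigenvalues of `Aᴴ * A`. -/
theorem sval_sq (A : Matrix m n ℂ) {i : ℕ} (hi : i < Fintype.card n) :
    sval A i ^ 2 = (isHermitian_conjTranspose_mul_self A).eigenvalues₀ ⟨i, hi⟩ := by
  have key : ∀ (S S' : EuclideanSpace ℂ n →ₗ[ℂ] EuclideanSpace ℂ n) (hS : S.IsSymmetric)
      (hS' : S'.IsSymmetric), S = S' →
      hS.eigenvalues (finrank_euclideanSpace (𝕜 := ℂ) (ι := n)) ⟨i, hi⟩ =
      hS'.eigenvalues (finrank_euclideanSpace (𝕜 := ℂ) (ι := n)) ⟨i, hi⟩ := by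
    intro S S' hS hS' h
    subst h
    rfl
  have h1 := LinearMap.sq_singularValues_of_lt (toEuclideanLin A)
    (finrank_euclideanSpace (𝕜 := ℂ) (ι := n)) hi
  rw [key _ _ _ (isSymmetric_toEuclideanLin_iff.mpr (isHermitian_conjTranspose_mul_self A))
    (adjoint_comp_toEuclideanLin A)] at h1
  exact h1

theorem sval_nonneg (A : Matrix m n ℂ) (i : ℕ) : 0 ≤ sval A i :=
  LinearMap.singularValues_nonneg _ i

theorem sval_antitone (A : Matrix m n ℂ) : Antitone (sval A) :=
  LinearMap.singularValues_antitone _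

theorem traceNorm_nonneg (A : Matrix m n ℂ) : 0 ≤ traceNorm A :=
  Finset.sum_nonneg fun i _ => sval_nonneg A i

theorem traceNorm_eq_sum_sqrt_eigenvalues (A : Matrix m n ℂ) :
    traceNorm A = ∑ i, √((isHermitian_conjTranspose_mul_self A).eigenvalues i) := by
  rw [traceNorm, Finset.sum_range]
  unfold IsHermitian.eigenvalues
  rw [Equiv.sum_comp (Fintype.equivOfCardEq (Fintype.card_fin _)).symm
    fun i => √((isHermitian_conjTranspose_mul_self A).eigenvalues₀ i)]
  refine Finset.sum_congr rfl fun i _ => ?_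
  rw [← sval_sq A i.2, Real.sqrt_sq (sval_nonneg A i)]

/-- The spectral theorem for a Hermitian matrix `A`, together with the formula for its trace norm:
the sum of the absolute values of the eigenvalues. -/
theorem exists_diagonalization {A : Matrix n n ℂ} (hA : A.IsHermitian) :
    ∃ (U : Matrix n n ℂ) (l : n → ℝ), Uᴴ * U = 1 ∧ U * Uᴴ = 1 ∧
      A = U * diagonal (fun i => (l i : ℂ)) * Uᴴ ∧ traceNorm A = ∑ i, |l i| := by
  set U : Matrix n n ℂ := hA.eigenvectorUnitary.1 with hU
  have h1 : Uᴴ * U = 1 := Unitary.coe_star_mul_self hA.eigenvectorUnitary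
  have h2 : U * Uᴴ = 1 := Unitary.coe_mul_star_self hA.eigenvectorUnitary
  have hsp : A = U * diagonal (fun i => (hA.eigenvalues i : ℂ)) * Uᴴ := hA.spectral_theorem
  refine ⟨U, hA.eigenvalues, h1, h2, hsp, ?_⟩
  have hsq : Aᴴ * A = U * diagonal (fun i => ((hA.eigenvalues i ^ 2 : ℝ) : ℂ)) * Uᴴ := by
    rw [hA.eq]
    conv_lhs => rw [hsp]
    rw [show U * diagonal (fun i => (hA.eigenvalues i : ℂ)) * Uᴴ *
        (U * diagonal (fun i => (hA.eigenvalues i : ℂ)) * Uᴴ) =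
        U * (diagonal (fun i => (hA.eigenvalues i : ℂ)) * (Uᴴ * U) *
          diagonal (fun i => (hA.eigenvalues i : ℂ))) * Uᴴ by simp only [Matrix.mul_assoc],
      h1, Matrix.mul_one, diagonal_mul_diagonal]
    simp [sq]
  have hchar : (Aᴴ * A).charpoly.roots =
      Multiset.map (fun i => ((hA.eigenvalues i ^ 2 : ℝ) : ℂ)) Finset.univ.val := by
    rw [hsq, charpoly_mul_comm, ← mul_assoc, h1, one_mul, charpoly_diagonal,
      Polynomial.roots_prod _ _
        (Finset.prod_ne_zero_iff.2 fun i _ => Polynomial.X_sub_C_ne_zero _)]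
    simp only [Polynomial.roots_X_sub_C, Multiset.bind_singleton]
  rw [(isHermitian_conjTranspose_mul_self A).roots_charpoly_eq_eigenvalues] at hchar
  have := congrArg (fun s => (s.map fun z : ℂ => √z.re).sum) hchar
  simp only [Multiset.map_map, Function.comp_def, Complex.coe_algebraMap, Complex.ofReal_re,
    Real.sqrt_sq_eq_abs] at this
  rw [traceNorm_eq_sum_sqrt_eigenvalues]
  exact this

/-- The Jordan decomposition attains the trace norm. -/
theorem exists_posSemidef_sub {A : Matrix n n ℂ} (hA : A.IsHermitian) :
    ∃ P N : Matrix n n ℂ, P.PosSemidef ∧ N.PosSemidef ∧ A = P - N ∧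
      P.trace.re + N.trace.re = traceNorm A := by
  obtain ⟨U, l, h1, -, hAU, htn⟩ := exists_diagonalization hA
  have htr : ∀ d : n → ℝ, (U * diagonal (fun i => (d i : ℂ)) * Uᴴ).trace.re = ∑ i, d i := by
    intro d
    rw [trace_mul_comm, ← mul_assoc, h1, one_mul, trace_diagonal]
    simp
  have hpos : ∀ d : n → ℝ, (∀ i, 0 ≤ d i) →
      (U * diagonal (fun i => (d i : ℂ)) * Uᴴ).PosSemidef := fun d hd =>
    (posSemidef_diagonal_iff.2 fun i => by exact_mod_cast hd i).mul_mul_conjTranspose_same U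
  refine ⟨_, _, hpos (fun i => max (l i) 0) fun i => le_max_right _ _,
    hpos (fun i => max (-l i) 0) fun i => le_max_right _ _, ?_, ?_⟩
  · rw [hAU, ← Matrix.sub_mul, ← Matrix.mul_sub, diagonal_sub]
    congr 3
    ext i
    rw [← Complex.ofReal_sub, max_zero_sub_max_neg_zero_eq_self]
  · rw [htr, htr, htn, ← Finset.sum_add_distrib]
    refine Finset.sum_congr rfl fun i _ => ?_
    exact max_zero_add_max_neg_zero_eq_abs_self _

/-- The trace norm is minimal among decompositions into positive parts: in an eigenbasis of `P - N`
the eigenvalues are the differences of the diagonal entries of `P` and `N`. -/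
theorem traceNorm_sub_le {P N : Matrix n n ℂ} (hP : P.PosSemidef) (hN : N.PosSemidef) :
    traceNorm (P - N) ≤ P.trace.re + N.trace.re := by
  obtain ⟨U, l, h1, h2, hAU, htn⟩ := exists_diagonalization (hP.isHermitian.sub hN.isHermitian)
  have hdiag : diagonal (fun i => (l i : ℂ)) = Uᴴ * P * U - Uᴴ * N * U := by
    rw [← Matrix.sub_mul, ← Matrix.mul_sub, hAU]
    rw [show Uᴴ * (U * diagonal (fun i => (l i : ℂ)) * Uᴴ) * U =
      (Uᴴ * U) * diagonal (fun i => (l i : ℂ)) * (Uᴴ * U) by simp only [Matrix.mul_assoc], h1]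
    simp
  have htr : ∀ X : Matrix n n ℂ, X.trace.re = ∑ i, ((Uᴴ * X * U) i i).re := by
    intro X
    rw [← Complex.re_sum]
    change _ = (Uᴴ * X * U).trace.re
    rw [trace_mul_comm, ← mul_assoc, h2, one_mul]
  rw [htn, htr P, htr N, ← Finset.sum_add_distrib]
  refine Finset.sum_le_sum fun i _ => ?_
  have h3 := congrArg Complex.re (congrFun (congrFun hdiag i) i)
  simp only [diagonal_apply_eq, Complex.ofReal_re, Matrix.sub_apply, Complex.sub_re] at h3
  have h4 : 0 ≤ ((Uᴴ * P * U) i i).re :=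
    (Complex.le_def.1 (hP.conjTranspose_mul_mul_same U).diag_nonneg).1
  have h5 : 0 ≤ ((Uᴴ * N * U) i i).re :=
    (Complex.le_def.1 (hN.conjTranspose_mul_mul_same U).diag_nonneg).1
  rw [h3, abs_le]
  constructor <;> linarith

theorem eq_zero_of_traceNorm_eq_zero {A : Matrix n n ℂ} (hA : A.IsHermitian)
    (h : traceNorm A = 0) : A = 0 := by
  obtain ⟨U, l, -, -, hAU, htn⟩ := exists_diagonalization hA
  rw [h] at htn
  have := (Finset.sum_eq_zero_iff_of_nonneg fun i _ => abs_nonneg (l i)).1 htn.symm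
  have hl : (fun i => (l i : ℂ)) = 0 := funext fun i => by simpa using this i (Finset.mem_univ i)
  rw [hAU, hl]
  simp

theorem posSemidef_smul_one_add_smul {H : Matrix n n ℂ} (hH : H.IsHermitian) {a b : ℝ}
    (h : ∀ i, 0 ≤ a + b * hH.eigenvalues i) :
    ((a : ℂ) • (1 : Matrix n n ℂ) + (b : ℂ) • H).PosSemidef := by
  set U : Matrix n n ℂ := hH.eigenvectorUnitary.1 with hU
  have h2 : U * Uᴴ = 1 := Unitary.coe_mul_star_self hH.eigenvectorUnitary
  have hsp : H = U * diagonal (fun i => (hH.eigenvalues i : ℂ)) * Uᴴ := hH.spectral_theorem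
  have : (a : ℂ) • (1 : Matrix n n ℂ) + (b : ℂ) • H =
      U * diagonal (fun i => ((a + b * hH.eigenvalues i : ℝ) : ℂ)) * Uᴴ := by
    conv_lhs => rw [hsp, ← h2, ← Matrix.smul_mul, ← Matrix.smul_mul, ← Matrix.add_mul]
    congr 1
    ext i j
    simp only [Matrix.add_apply, Matrix.smul_apply, mul_diagonal, smul_eq_mul]
    push_cast
    ring
  rw [this]
  exact (posSemidef_diagonal_iff.2 fun i => by exact_mod_cast h i).mul_mul_conjTranspose_same U

theorem posSemidef_conjTranspose_mul_self_sub (A : Matrix m n ℂ) {c : ℝ} (hc : 0 ≤ c)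
    (h : ∀ i < Fintype.card n, c ≤ sval A i) :
    (Aᴴ * A - ((c ^ 2 : ℝ) : ℂ) • (1 : Matrix n n ℂ)).PosSemidef := by
  have := posSemidef_smul_one_add_smul (isHermitian_conjTranspose_mul_self A)
    (a := -c ^ 2) (b := 1) fun i => by
      rw [IsHermitian.eigenvalues, ← sval_sq A (Fin.is_lt _), one_mul, neg_add_eq_sub, sub_nonneg]
      exact pow_le_pow_left₀ hc (h _ (Fin.is_lt _)) 2
  convert this using 1
  push_cast
  module

theorem posSemidef_sub_conjTranspose_mul_self (A : Matrix m n ℂ) :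
    (((sval A 0 ^ 2 : ℝ) : ℂ) • (1 : Matrix n n ℂ) - Aᴴ * A).PosSemidef := by
  have := posSemidef_smul_one_add_smul (isHermitian_conjTranspose_mul_self A)
    (a := sval A 0 ^ 2) (b := -1) fun i => by
      rw [IsHermitian.eigenvalues, ← sval_sq A (Fin.is_lt _), neg_one_mul, ← sub_eq_add_neg,
        sub_nonneg]
      exact pow_le_pow_left₀ (sval_nonneg _ _) (sval_antitone A (Nat.zero_le _)) 2
  convert this using 1
  push_cast
  module

/-- An injective matrix has a positive smallest singular value. -/
theorem exists_pos_le_sval {A : Matrix m n ℂ} (h : Function.Injective (toEuclideanLin A)) :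
    ∃ c : ℝ, 0 < c ∧ ∀ i < Fintype.card n, c ≤ sval A i := by
  have hpos := (LinearMap.injective_iff_forall_lt_finrank_singularValues_pos _).1 h
  rw [finrank_euclideanSpace] at hpos
  rcases Nat.eq_zero_or_pos (Fintype.card n) with h0 | h0
  · exact ⟨1, one_pos, fun i hi => by omega⟩
  · exact ⟨sval A (Fintype.card n - 1), hpos _ (by omega),
      fun i hi => sval_antitone A (by omega)⟩

end TraceNorm

/-! ### Normalization to trace one -/

/-- Normalizing to trace one costs at most a factor `2`: if `A - B = R - Q` with `R`, `Q` positive,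
the normalized matrices differ by `(A - B) / tr A` and a multiple of `B` of trace norm
`|tr A - tr B| / tr A`. -/
theorem traceNorm_normalized_sub_le {n : Type*} [Fintype n] [DecidableEq n] {A B R Q : Matrix n n ℂ}
    (hA : A.PosSemidef) (hB : B.PosSemidef) (hR : R.PosSemidef) (hQ : Q.PosSemidef)
    (hAB : A - B = R - Q) (ha0 : 0 < A.trace.re) (hb0 : 0 < B.trace.re) :
    traceNorm (A.trace⁻¹ • A - B.trace⁻¹ • B) ≤
      2 * (R.trace.re + Q.trace.re) * A.trace.re⁻¹ := by
  set a := A.trace.re with ha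
  set b := B.trace.re with hb
  have hAtr : A.trace = (a : ℂ) := (ofReal_trace_re hA).symm
  have hBtr : B.trace = (b : ℂ) := (ofReal_trace_re hB).symm
  have hab : a - b = R.trace.re - Q.trace.re := by
    have := congrArg (fun Z => (Matrix.trace Z).re) hAB
    simpa only [trace_sub, Complex.sub_re] using this
  set κ := a⁻¹ - b⁻¹ with hκ
  have hdecomp : A.trace⁻¹ • A - B.trace⁻¹ • B =
      (((a⁻¹ : ℝ) : ℂ) • R + ((max κ 0 : ℝ) : ℂ) • B) -
        (((a⁻¹ : ℝ) : ℂ) • Q + ((max (-κ) 0 : ℝ) : ℂ) • B) := by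
    have h1 : ((a⁻¹ : ℝ) : ℂ) - ((b⁻¹ : ℝ) : ℂ) =
        ((max κ 0 : ℝ) : ℂ) - ((max (-κ) 0 : ℝ) : ℂ) := by
      rw [← Complex.ofReal_sub, ← Complex.ofReal_sub, max_zero_sub_max_neg_zero_eq_self]
    have h2 : A = R - Q + B := by rw [← hAB, sub_add_cancel]
    rw [hAtr, hBtr, ← Complex.ofReal_inv, ← Complex.ofReal_inv]
    calc ((a⁻¹ : ℝ) : ℂ) • A - ((b⁻¹ : ℝ) : ℂ) • B
        = ((a⁻¹ : ℝ) : ℂ) • (R - Q) + (((a⁻¹ : ℝ) : ℂ) - ((b⁻¹ : ℝ) : ℂ)) • B := by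
          rw [h2]; module
      _ = _ := by rw [h1]; module
  have hps : ∀ {t : ℝ} {Z : Matrix n n ℂ}, 0 ≤ t → Z.PosSemidef →
      ((t : ℂ) • Z).PosSemidef := fun ht hZ => hZ.smul (by exact_mod_cast ht)
  have hain : 0 ≤ a⁻¹ := inv_nonneg.2 ha0.le
  rw [hdecomp]
  refine (traceNorm_sub_le ((hps hain hR).add (hps (le_max_right _ _) hB))
    ((hps hain hQ).add (hps (le_max_right _ _) hB))).trans ?_
  simp only [trace_add, trace_smul, Complex.add_re, smul_eq_mul, Complex.re_ofReal_mul]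
  have hκb : |κ| * b = a⁻¹ * |R.trace.re - Q.trace.re| := by
    rw [← hab, hκ, inv_sub_inv ha0.ne' hb0.ne', abs_div, abs_sub_comm, abs_of_pos (mul_pos ha0 hb0)]
    field_simp
  have habs : |R.trace.re - Q.trace.re| ≤ R.trace.re + Q.trace.re := by
    have := trace_re_nonneg hQ
    have := trace_re_nonneg hR
    rw [abs_le]
    constructor <;> linarith
  have hκs : max κ 0 + max (-κ) 0 = |κ| := max_zero_add_max_neg_zero_eq_abs_self κ
  calc a⁻¹ * R.trace.re + max κ 0 * b + (a⁻¹ * Q.trace.re + max (-κ) 0 * b)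
      = a⁻¹ * (R.trace.re + Q.trace.re) + (max κ 0 + max (-κ) 0) * b := by ring
    _ = a⁻¹ * (R.trace.re + Q.trace.re) + a⁻¹ * |R.trace.re - Q.trace.re| := by rw [hκs, hκb]
    _ ≤ a⁻¹ * (R.trace.re + Q.trace.re) + a⁻¹ * (R.trace.re + Q.trace.re) := by gcongr
    _ = 2 * (R.trace.re + Q.trace.re) * a⁻¹ := by ring

/-! ### Contraction of a positive matrix with an environment -/

section Contract

variable {L : Type*} [DecidableEq L] {D : ℕ}

/-- The configuration of all legs with value `j` on the leg `n` and `x` on the others. -/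
def glue (n : L) (j : Fin D) (x : {m // m ≠ n} → Fin D) : L → Fin D :=
  fun m => if h : m = n then j else x ⟨m, h⟩

theorem glue_inj {n : L} {j k : Fin D} {x y : {m // m ≠ n} → Fin D} :
    glue n j x = glue n k y ↔ j = k ∧ x = y := by
  refine ⟨fun h => ⟨by simpa [glue] using congrFun h n, funext fun m => ?_⟩, ?_⟩
  · simpa [glue, m.2] using congrFun h m
  · rintro ⟨rfl, rfl⟩
    rfl

variable [Fintype L]

/-- The superoperator with Choi-type matrix `M`: the legs other than `n` of the two sides of `M`
are contracted with `X`, and `n` is left open. A PEPS tensor `T` enters only through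
`M = Tᴴ * T`, whose row index belongs to the conjugate of `T`, that is, to the column index of
`X` and of the result. -/
def contract (M : Matrix (L → Fin D) (L → Fin D) ℂ) (n : L)
    (X : Matrix ({m // m ≠ n} → Fin D) ({m // m ≠ n} → Fin D) ℂ) : Matrix (Fin D) (Fin D) ℂ :=
  of fun j k => ∑ x, ∑ y, X x y * M (glue n k y) (glue n j x)

theorem contract_sub_left (M M' : Matrix (L → Fin D) (L → Fin D) ℂ) (n : L)
    (X : Matrix ({m // m ≠ n} → Fin D) ({m // m ≠ n} → Fin D) ℂ) :
    contract (M - M') n X = contract M n X - contract M' n X := by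
  ext j k
  simp [contract, mul_sub]

theorem contract_sub_right (M : Matrix (L → Fin D) (L → Fin D) ℂ) (n : L)
    (X Y : Matrix ({m // m ≠ n} → Fin D) ({m // m ≠ n} → Fin D) ℂ) :
    contract M n (X - Y) = contract M n X - contract M n Y := by
  ext j k
  simp [contract, sub_mul]

theorem contract_smul_one (c : ℂ) (n : L)
    (X : Matrix ({m // m ≠ n} → Fin D) ({m // m ≠ n} → Fin D) ℂ) :
    contract (c • (1 : Matrix (L → Fin D) (L → Fin D) ℂ)) n X = (c * X.trace) • 1 := by
  ext j k
  by_cases hjk : j = k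
  · simp [contract, Matrix.one_apply, glue_inj, hjk, Matrix.trace, Finset.mul_sum, mul_comm]
  · simp [contract, Matrix.one_apply, glue_inj, hjk, Ne.symm hjk]

theorem sum_kraus_mul_mul_conjTranspose {p : Type*} [Fintype p] (T : Matrix p (L → Fin D) ℂ)
    (n : L) (X : Matrix ({m // m ≠ n} → Fin D) ({m // m ≠ n} → Fin D) ℂ) :
    ∑ a, (of fun j x => T a (glue n j x)) * X * (of fun j x => T a (glue n j x))ᴴ =
      contract (Tᴴ * T) n X := by
  ext j k
  simp only [Matrix.sum_apply, Matrix.mul_apply, contract, of_apply, conjTranspose_apply,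
    Finset.sum_mul, Finset.mul_sum]
  rw [Finset.sum_comm]
  refine (Finset.sum_congr rfl fun y _ => Finset.sum_comm).trans ?_
  rw [Finset.sum_comm]
  refine Finset.sum_congr rfl fun x _ => Finset.sum_congr rfl fun y _ =>
    Finset.sum_congr rfl fun a _ => ?_
  ring

/-- Complete positivity: a positive semidefinite `M` is a Gram matrix `Bᴴ * B`, so contraction
with `M` has a Kraus form. -/
theorem posSemidef_contract {M : Matrix (L → Fin D) (L → Fin D) ℂ} (hM : M.PosSemidef) (n : L)
    {X : Matrix ({m // m ≠ n} → Fin D) ({m // m ≠ n} → Fin D) ℂ} (hX : X.PosSemidef) :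
    (contract M n X).PosSemidef := by
  obtain ⟨B, rfl⟩ : ∃ B, M = Bᴴ * B := exists_eq_conjTranspose_mul_self hM
  rw [← sum_kraus_mul_mul_conjTranspose]
  exact posSemidef_sum _ fun a _ => hX.mul_mul_conjTranspose_same _

theorem le_trace_contract {M : Matrix (L → Fin D) (L → Fin D) ℂ} {c : ℝ}
    (hM : (M - (c : ℂ) • 1).PosSemidef) (n : L)
    {X : Matrix ({m // m ≠ n} → Fin D) ({m // m ≠ n} → Fin D) ℂ} (hX : X.PosSemidef) :
    c * D * X.trace.re ≤ (contract M n X).trace.re := by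
  have h := trace_re_nonneg (posSemidef_contract hM n hX)
  rw [contract_sub_left, contract_smul_one, trace_sub, trace_smul, trace_one, Fintype.card_fin,
    ← ofReal_trace_re hX, smul_eq_mul] at h
  have h2 : (((c : ℂ) * (X.trace.re : ℂ)) * (D : ℂ)).re = c * D * X.trace.re := by
    norm_cast
    ring
  rw [Complex.sub_re, h2] at h
  linarith

theorem trace_contract_le {M : Matrix (L → Fin D) (L → Fin D) ℂ} {c : ℝ}
    (hM : ((c : ℂ) • 1 - M).PosSemidef) (n : L)
    {X : Matrix ({m // m ≠ n} → Fin D) ({m // m ≠ n} → Fin D) ℂ} (hX : X.PosSemidef) :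
    (contract M n X).trace.re ≤ c * D * X.trace.re := by
  have h := trace_re_nonneg (posSemidef_contract hM n hX)
  rw [contract_sub_left, contract_smul_one, trace_sub, trace_smul, trace_one, Fintype.card_fin,
    ← ofReal_trace_re hX, smul_eq_mul] at h
  have h2 : (((c : ℂ) * (X.trace.re : ℂ)) * (D : ℂ)).re = c * D * X.trace.re := by
    norm_cast
    ring
  rw [Complex.sub_re, h2] at h
  linarith

/-- If `c ≤ M ≤ s` then normalized contraction with `M` is Lipschitz for the trace norm, with
constant `2 (s - c) / c`: contraction with the scalar `s` gives the same multiple of the identity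
for both environments, so only the small positive part `s - M ≤ s - c` sees their difference. -/
theorem traceNorm_normalized_contract_sub_le (hD : 0 < D) {M : Matrix (L → Fin D) (L → Fin D) ℂ}
    {s c : ℝ} (hc : 0 < c) (hcM : (M - (c : ℂ) • 1).PosSemidef)
    (hMs : ((s : ℂ) • 1 - M).PosSemidef) (n : L)
    {X Y P N : Matrix ({m // m ≠ n} → Fin D) ({m // m ≠ n} → Fin D) ℂ} (hX : X.PosSemidef)
    (hY : Y.PosSemidef) (hX1 : X.trace = 1) (hY1 : Y.trace = 1) (hP : P.PosSemidef)
    (hN : N.PosSemidef) (hXY : X - Y = P - N) :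
    traceNorm ((contract M n X).trace⁻¹ • contract M n X -
      (contract M n Y).trace⁻¹ • contract M n Y) ≤
      2 * (s - c) / c * (P.trace.re + N.trace.re) := by
  have hMpos : M.PosSemidef := by
    have := hcM.add (PosSemidef.one.smul (a := (c : ℂ)) (by exact_mod_cast hc.le))
    rwa [sub_add_cancel] at this
  have hE : (((s - c : ℝ) : ℂ) • 1 - ((s : ℂ) • 1 - M)).PosSemidef := by
    convert hcM using 1
    push_cast
    module
  obtain ⟨A, hA⟩ : ∃ Z, Z = contract M n X := ⟨_, rfl⟩
  obtain ⟨B, hB⟩ : ∃ Z, Z = contract M n Y := ⟨_, rfl⟩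
  obtain ⟨Q, hQ⟩ : ∃ Z, Z = contract ((s : ℂ) • 1 - M) n P := ⟨_, rfl⟩
  obtain ⟨R, hR⟩ : ∃ Z, Z = contract ((s : ℂ) • 1 - M) n N := ⟨_, rfl⟩
  have hApos : A.PosSemidef := hA ▸ posSemidef_contract hMpos n hX
  have hBpos : B.PosSemidef := hB ▸ posSemidef_contract hMpos n hY
  have hQpos : Q.PosSemidef := hQ ▸ posSemidef_contract hMs n hP
  have hRpos : R.PosSemidef := hR ▸ posSemidef_contract hMs n hN
  have htr : P.trace = N.trace := by
    have := congrArg Matrix.trace hXY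
    rw [trace_sub, trace_sub, hX1, hY1, sub_self] at this
    exact (sub_eq_zero.1 this.symm)
  have hAB : A - B = R - Q := by
    rw [hA, hB, hR, hQ, ← contract_sub_right, hXY, contract_sub_right, contract_sub_left,
      contract_sub_left, contract_smul_one, contract_smul_one, htr]
    abel
  have hQle : Q.trace.re ≤ (s - c) * D * P.trace.re := hQ ▸ trace_contract_le hE n hP
  have hRle : R.trace.re ≤ (s - c) * D * N.trace.re := hR ▸ trace_contract_le hE n hN
  have hDr : (0 : ℝ) < D := by exact_mod_cast hD
  have haD : c * D ≤ A.trace.re := by simpa [hX1, hA] using le_trace_contract hcM n hX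
  have hbD : c * D ≤ B.trace.re := by simpa [hY1, hB] using le_trace_contract hcM n hY
  have hcD : 0 < c * D := mul_pos hc hDr
  have hRQ : R.trace.re + Q.trace.re ≤ (s - c) * D * (P.trace.re + N.trace.re) := by
    rw [mul_add, add_comm]
    exact add_le_add hQle hRle
  have hQ0 := trace_re_nonneg hQpos
  have hR0 := trace_re_nonneg hRpos
  rw [← hA, ← hB]
  refine (traceNorm_normalized_sub_le hApos hBpos hRpos hQpos hAB (hcD.trans_le haD)
    (hcD.trans_le hbD)).trans ?_
  calc 2 * (R.trace.re + Q.trace.re) * A.trace.re⁻¹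
      ≤ 2 * (R.trace.re + Q.trace.re) * (c * D)⁻¹ := by gcongr
    _ ≤ 2 * ((s - c) * D * (P.trace.re + N.trace.re)) * (c * D)⁻¹ := by gcongr
    _ = _ := by field_simp

end Contract

/-! ### Tensor products of messages -/

section TensorProd

variable {ι : Type*} [Fintype ι] [DecidableEq ι] {D : ℕ}

theorem trace_tensorProd (A : ι → Matrix (Fin D) (Fin D) ℂ) :
    (tensorProd A).trace = ∏ i, (A i).trace := by
  simp only [Matrix.trace, tensorProd, diag_apply, of_apply]
  rw [Finset.prod_univ_sum, Fintype.piFinset_univ]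

theorem tensorProd_mul (A B : ι → Matrix (Fin D) (Fin D) ℂ) :
    tensorProd (fun i => A i * B i) = tensorProd A * tensorProd B := by
  ext x y
  simp only [tensorProd, of_apply, Matrix.mul_apply]
  rw [Finset.prod_univ_sum, Fintype.piFinset_univ]
  exact Finset.sum_congr rfl fun z _ => Finset.prod_mul_distrib

theorem posSemidef_tensorProd {A : ι → Matrix (Fin D) (Fin D) ℂ} (hA : ∀ i, (A i).PosSemidef) :
    (tensorProd A).PosSemidef := by
  choose B hB using fun i => exists_eq_conjTranspose_mul_self (hA i)
  have h : tensorProd A = (tensorProd B)ᴴ * tensorProd B := by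
    rw [show A = fun i => (B i)ᴴ * B i from funext hB, tensorProd_mul]
    congr 1
    ext x y
    simp [tensorProd, conjTranspose_apply]
  rw [h]
  exact posSemidef_conjTranspose_mul_self _

theorem tensorProd_update_sub (A : ι → Matrix (Fin D) (Fin D) ℂ) (i : ι)
    (X Y : Matrix (Fin D) (Fin D) ℂ) :
    tensorProd (Function.update A i (X - Y)) =
      tensorProd (Function.update A i X) - tensorProd (Function.update A i Y) := by
  ext x y
  simp only [tensorProd, of_apply, Matrix.sub_apply]
  rw [← Finset.mul_prod_erase _ _ (Finset.mem_univ i),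
    ← Finset.mul_prod_erase _ _ (Finset.mem_univ i),
    ← Finset.mul_prod_erase _ _ (Finset.mem_univ i)]
  have : ∀ Z : Matrix (Fin D) (Fin D) ℂ,
      ∏ j ∈ Finset.univ.erase i, Function.update A i Z j (x j) (y j) =
        ∏ j ∈ Finset.univ.erase i, A j (x j) (y j) := fun Z =>
    Finset.prod_congr rfl fun j hj => by rw [Function.update_of_ne (Finset.ne_of_mem_erase hj)]
  simp only [this, Function.update_self, Matrix.sub_apply, sub_mul]

/-- Telescoping: replacing the factors of a tensor product of density matrices one at a time
writes the difference of two such products as `P - N` with `P`, `N` positive and of total trace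
the sum of the trace norms of the differences of the factors. -/
theorem exists_tensorProd_sub {A B : ι → Matrix (Fin D) (Fin D) ℂ}
    (hA : ∀ i, (A i).PosSemidef) (hB : ∀ i, (B i).PosSemidef) (hA1 : ∀ i, (A i).trace = 1)
    (hB1 : ∀ i, (B i).trace = 1) :
    ∃ P N : Matrix (ι → Fin D) (ι → Fin D) ℂ, P.PosSemidef ∧ N.PosSemidef ∧
      tensorProd A - tensorProd B = P - N ∧
      P.trace.re + N.trace.re = ∑ i, traceNorm (A i - B i) := by
  suffices H : ∀ s : Finset ι, ∃ P N : Matrix (ι → Fin D) (ι → Fin D) ℂ,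
      P.PosSemidef ∧ N.PosSemidef ∧ tensorProd (s.piecewise A B) - tensorProd B = P - N ∧
      P.trace.re + N.trace.re = ∑ i ∈ s, traceNorm (A i - B i) by
    simpa only [Finset.piecewise_univ] using H Finset.univ
  intro s
  induction s using Finset.induction_on with
  | empty => exact ⟨0, 0, .zero, .zero, by simp, by simp⟩
  | insert i s hi ih =>
    obtain ⟨P, N, hP, hN, hPN, htr⟩ := ih
    obtain ⟨P', N', hP', hN', hPN', htr'⟩ :=
      exists_posSemidef_sub ((hA i).isHermitian.sub (hB i).isHermitian)
    set C := s.piecewise A B with hC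
    have hCpos : ∀ j, (C j).PosSemidef := fun j => by
      by_cases hj : j ∈ s <;> simp [hC, hj, hA, hB]
    have hC1 : ∀ j, (C j).trace = 1 := fun j => by
      by_cases hj : j ∈ s <;> simp [hC, hj, hA1, hB1]
    have hup : ∀ {Z : Matrix (Fin D) (Fin D) ℂ}, Z.PosSemidef →
        (tensorProd (Function.update C i Z)).PosSemidef := fun {Z} hZ =>
      posSemidef_tensorProd fun j => by
        rcases eq_or_ne j i with rfl | hj
        · simpa using hZ
        · simpa [Function.update_of_ne hj] using hCpos j
    have hutr : ∀ Z : Matrix (Fin D) (Fin D) ℂ,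
        (tensorProd (Function.update C i Z)).trace = Z.trace := fun Z => by
      rw [trace_tensorProd, Finset.prod_eq_single_of_mem i (Finset.mem_univ i)]
      · simp
      · intro j _ hj
        rw [Function.update_of_ne hj, hC1]
    refine ⟨P + tensorProd (Function.update C i P'), N + tensorProd (Function.update C i N'),
      hP.add (hup hP'), hN.add (hup hN'), ?_, ?_⟩
    · have h1 : tensorProd ((insert i s).piecewise A B) - tensorProd C =
          tensorProd (Function.update C i P') - tensorProd (Function.update C i N') := by
        rw [← tensorProd_update_sub, ← hPN', tensorProd_update_sub, Finset.piecewise_insert]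
        congr 2
        rw [eq_comm, Function.update_eq_self_iff]
        simp [hC, hi]
      calc tensorProd ((insert i s).piecewise A B) - tensorProd B
          = (tensorProd ((insert i s).piecewise A B) - tensorProd C) +
            (tensorProd C - tensorProd B) := by abel
        _ = _ := by rw [h1, hPN]; abel
    · rw [Finset.sum_insert hi, ← htr, ← htr', trace_add, trace_add, hutr, hutr, Complex.add_re,
        Complex.add_re]
      ring

end TensorProd

/-! ### The set of density messages -/

theorem norm_apply_le_one_of_posSemidef {n : Type*} [Fintype n] [DecidableEq n] {A : Matrix n n ℂ}
    (hA : A.PosSemidef) (h1 : A.trace = 1) (i j : n) : ‖A i j‖ ≤ 1 := by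
  obtain ⟨B, rfl⟩ : ∃ B, A = Bᴴ * B := exists_eq_conjTranspose_mul_self hA
  have hdiag : ∀ i, ((Bᴴ * B) i i).re = ∑ k, ‖B k i‖ ^ 2 := fun i => by
    simp only [Matrix.mul_apply, conjTranspose_apply, Complex.re_sum]
    refine Finset.sum_congr rfl fun k _ => ?_
    rw [← Complex.normSq_eq_norm_sq, Complex.star_def, ← Complex.normSq_eq_conj_mul_self,
      Complex.ofReal_re]
  have hle : ∀ i, ∑ k, ‖B k i‖ ^ 2 ≤ 1 := fun i => by
    have htr : ∑ i, ∑ k, ‖B k i‖ ^ 2 = 1 := by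
      have := congrArg Complex.re h1
      simpa only [Matrix.trace, diag_apply, Complex.re_sum, hdiag, Complex.one_re] using this
    rw [← htr]
    exact Finset.single_le_sum (f := fun i => ∑ k, ‖B k i‖ ^ 2)
      (fun i _ => Finset.sum_nonneg fun k _ => sq_nonneg _) (Finset.mem_univ i)
  calc ‖(Bᴴ * B) i j‖ ≤ ∑ k, ‖B k i‖ * ‖B k j‖ := by
        rw [Matrix.mul_apply]
        refine (norm_sum_le _ _).trans (Finset.sum_le_sum fun k _ => ?_)
        rw [norm_mul, conjTranspose_apply, norm_star]
    _ ≤ ∑ k, (‖B k i‖ ^ 2 + ‖B k j‖ ^ 2) / 2 :=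
        Finset.sum_le_sum fun k _ => by nlinarith [sq_nonneg (‖B k i‖ - ‖B k j‖)]
    _ = (∑ k, ‖B k i‖ ^ 2 + ∑ k, ‖B k j‖ ^ 2) / 2 := by
        rw [← Finset.sum_div, Finset.sum_add_distrib]
    _ ≤ 1 := by linarith [hle i, hle j]

/-- Density matrices form a closed set, and their entries are bounded by `1`. -/
theorem isCompact_setOf_density (n : Type*) [Fintype n] [DecidableEq n] :
    IsCompact {A : Matrix n n ℂ | A.PosSemidef ∧ A.trace = 1} := by
  have hbox : IsCompact
      {A : Matrix n n ℂ | ∀ i, A i ∈ {r : n → ℂ | ∀ j, r j ∈ Metric.closedBall 0 1}} :=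
    isCompact_pi_infinite fun _ => isCompact_pi_infinite fun _ => isCompact_closedBall _ _
  refine hbox.of_isClosed_subset ?_ fun A hA i j => by
    simpa using norm_apply_le_one_of_posSemidef hA.1 hA.2 i j
  have hset : {A : Matrix n n ℂ | A.PosSemidef ∧ A.trace = 1} =
      {A | Aᴴ = A} ∩ (⋂ x : n → ℂ, {A | 0 ≤ star x ⬝ᵥ (A *ᵥ x)}) ∩ {A | A.trace = 1} := by
    ext A
    simp [posSemidef_iff_dotProduct_mulVec, IsHermitian]
  rw [hset]
  refine ((isClosed_eq (by fun_prop) continuous_id).inter (isClosed_iInter fun x => ?_)).inter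
    (isClosed_eq (by fun_prop) continuous_const)
  exact isClosed_le continuous_const (by fun_prop)

variable {V : Type*} {G : SimpleGraph V} {D d : ℕ}

theorem isCompact_densityMessages : IsCompact (densityMessages G D) :=
  isCompact_pi_infinite fun _ => isCompact_setOf_density (Fin D)

theorem convex_densityMessages : Convex ℝ (densityMessages G D) := by
  intro μ hμ ν hν a b ha hb hab e
  refine ⟨((hμ e).1.smul ha).add ((hν e).1.smul hb), ?_⟩
  change (a • μ e + b • ν e).trace = 1
  rw [trace_add, trace_smul, trace_smul, (hμ e).2, (hν e).2, ← add_smul, hab, one_smul]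

theorem densityMessages_nonempty (hD : 0 < D) : (densityMessages G D).Nonempty := by
  refine ⟨fun _ => (D : ℂ)⁻¹ • 1, fun e => ⟨PosSemidef.one.smul (by positivity), ?_⟩⟩
  rw [trace_smul, trace_one, Fintype.card_fin, smul_eq_mul]
  exact inv_mul_cancel₀ (by exact_mod_cast hD.ne')

/-! ### The norm on messages -/

section MaxNorm

theorem maxNorm_nonneg (μ : Messages G D) : 0 ≤ maxNorm μ :=
  Real.iSup_nonneg fun _ => traceNorm_nonneg _

theorem maxNorm_sub_le_two {μ ν : Messages G D} (hμ : μ ∈ densityMessages G D)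
    (hν : ν ∈ densityMessages G D) : maxNorm (μ - ν) ≤ 2 := by
  refine Real.iSup_le (fun e => (traceNorm_sub_le (hμ e).1 (hν e).1).trans ?_) zero_le_two
  rw [(hμ e).2, (hν e).2, Complex.one_re]
  norm_num

variable [Finite G.Dart]

theorem traceNorm_le_maxNorm (μ : Messages G D) (e : G.Dart) : traceNorm (μ e) ≤ maxNorm μ :=
  le_ciSup (f := fun e => traceNorm (μ e)) (Set.finite_range _).bddAbove e

theorem eq_of_maxNorm_sub_le_zero {μ ν : Messages G D} (hμ : μ ∈ densityMessages G D)
    (hν : ν ∈ densityMessages G D) (h : maxNorm (μ - ν) ≤ 0) : μ = ν := by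
  funext e
  exact sub_eq_zero.1 <| eq_zero_of_traceNorm_eq_zero
    ((hμ e).1.isHermitian.sub (hν e).1.isHermitian)
    (le_antisymm ((traceNorm_le_maxNorm (μ - ν) e).trans h) (traceNorm_nonneg _))

end MaxNorm

/-! ### The message-passing map -/

section BPMap

variable [Fintype V] [DecidableEq V] [DecidableRel G.Adj]

/-- The environment `⨂_{m ∈ N(v) \ {n}} μ_{(m,v)}` of the directed edge `e = (v, n)`. -/
def environment (μ : Messages G D) (e : G.Dart) :
    Matrix (OtherLegs G e.fst (outLeg e) → Fin D) (OtherLegs G e.fst (outLeg e) → Fin D) ℂ :=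
  tensorProd fun m => μ (inDart G e.fst m.1)

theorem posSemidef_environment {μ : Messages G D} (hμ : μ ∈ densityMessages G D) (e : G.Dart) :
    (environment μ e).PosSemidef :=
  posSemidef_tensorProd fun _ => (hμ _).1

theorem trace_environment {μ : Messages G D} (hμ : μ ∈ densityMessages G D) (e : G.Dart) :
    (environment μ e).trace = 1 := by
  rw [environment, trace_tensorProd]
  exact Finset.prod_eq_one fun m _ => (hμ _).2

namespace PEPS

theorem unnormalizedMap_eq_contract (ψ : PEPS G D d) (μ : Messages G D) (e : G.Dart) :
    ψ.unnormalizedMap μ e =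
      contract ((ψ.tensor e.fst)ᴴ * ψ.tensor e.fst) (outLeg e) (environment μ e) :=
  sum_kraus_mul_mul_conjTranspose (ψ.tensor e.fst) (outLeg e) (environment μ e)

theorem posSemidef_unnormalizedMap (ψ : PEPS G D d) {μ : Messages G D}
    (hμ : μ ∈ densityMessages G D) (e : G.Dart) : (ψ.unnormalizedMap μ e).PosSemidef := by
  rw [unnormalizedMap_eq_contract]
  exact posSemidef_contract (posSemidef_conjTranspose_mul_self _) _ (posSemidef_environment hμ e)

theorem le_trace_unnormalizedMap (ψ : PEPS G D d) {μ : Messages G D}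
    (hμ : μ ∈ densityMessages G D) (e : G.Dart) {c : ℝ} (hc : 0 ≤ c)
    (h : ∀ i < Fintype.card (G.neighborSet e.fst → Fin D), c ≤ sval (ψ.tensor e.fst) i) :
    c ^ 2 * D ≤ (ψ.unnormalizedMap μ e).trace.re := by
  have := le_trace_contract (posSemidef_conjTranspose_mul_self_sub _ hc h) (outLeg e)
    (posSemidef_environment hμ e)
  rwa [trace_environment hμ, Complex.one_re, mul_one, ← unnormalizedMap_eq_contract] at this

theorem trace_unnormalizedMap_pos {ψ : PEPS G D d} (hD : 0 < D) (hψ : ψ.IsInjective)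
    {μ : Messages G D} (hμ : μ ∈ densityMessages G D) (e : G.Dart) :
    0 < (ψ.unnormalizedMap μ e).trace.re := by
  obtain ⟨c, hc, h⟩ := exists_pos_le_sval (hψ e.fst)
  have hDr : (0 : ℝ) < D := by exact_mod_cast hD
  exact (mul_pos (pow_pos hc 2) hDr).trans_le (ψ.le_trace_unnormalizedMap hμ e hc.le h)

theorem mapsTo_bpMap {ψ : PEPS G D d} (hD : 0 < D) (hψ : ψ.IsInjective) :
    Set.MapsTo ψ.bpMap (densityMessages G D) (densityMessages G D) := by
  intro μ hμ e
  have hpos := trace_unnormalizedMap_pos hD hψ hμ e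
  have htr := ofReal_trace_re (ψ.posSemidef_unnormalizedMap hμ e)
  constructor
  · have h0 : 0 ≤ (ψ.unnormalizedMap μ e).trace⁻¹ := by
      rw [← htr, ← Complex.ofReal_inv]
      exact_mod_cast inv_nonneg.2 hpos.le
    exact (ψ.posSemidef_unnormalizedMap hμ e).smul h0
  · change ((ψ.unnormalizedMap μ e).trace⁻¹ • ψ.unnormalizedMap μ e).trace = 1
    rw [trace_smul, smul_eq_mul, inv_mul_cancel₀]
    rw [← htr]
    exact_mod_cast hpos.ne'

theorem continuous_unnormalizedMap (ψ : PEPS G D d) (e : G.Dart) :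
    Continuous fun μ : Messages G D => ψ.unnormalizedMap μ e := by
  simp only [unnormalizedMap_eq_contract]
  refine continuous_matrix fun j k => ?_
  simp only [contract, environment, tensorProd, of_apply]
  fun_prop

theorem continuousOn_bpMap {ψ : PEPS G D d} (hD : 0 < D) (hψ : ψ.IsInjective) :
    ContinuousOn ψ.bpMap (densityMessages G D) := by
  refine continuousOn_pi.2 fun e => ?_
  have hc := ψ.continuous_unnormalizedMap e
  refine ContinuousOn.smul (ContinuousOn.inv₀ hc.matrix_trace.continuousOn fun μ hμ h0 => ?_)
    hc.continuousOn
  exact (trace_unnormalizedMap_pos hD hψ hμ e).ne' (by rw [h0, Complex.zero_re])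

/-- Existence of a fixed point needs injectivity only, through Brouwer's theorem. -/
theorem exists_fixedPoint_bpMap {ψ : PEPS G D d} (hD : 0 < D) (hψ : ψ.IsInjective) :
    ∃ μ ∈ densityMessages G D, ψ.bpMap μ = μ :=
  exists_fixedPoint_of_isCompact_convex isCompact_densityMessages convex_densityMessages
    (densityMessages_nonempty hD) (continuousOn_bpMap hD hψ) (mapsTo_bpMap hD hψ)

/-- The contraction estimate. With `σ` the largest singular value of `T_v`, the Gram matrix
`T_vᴴ * T_v` lies between `(δ * σ) ^ 2` and `σ ^ 2`; the factor `2 * (1 - δ ^ 2) / δ ^ 2` on each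
edge is multiplied by the number, at most `Δ - 1`, of incoming messages. -/
theorem maxNorm_bpMap_sub_le {ψ : PEPS G D d} (hD : 0 < D) {δ : ℝ} (hδ0 : 0 < δ) (hδ1 : δ ≤ 1)
    (hψ : ψ.IsDeltaInjective δ) (hΔ : 1 ≤ G.maxDegree) {μ ν : Messages G D}
    (hμ : μ ∈ densityMessages G D) (hν : ν ∈ densityMessages G D) :
    maxNorm (ψ.bpMap μ - ψ.bpMap ν) ≤
      2 * ((G.maxDegree : ℝ) - 1) * (1 - δ ^ 2) / δ ^ 2 * maxNorm (μ - ν) := by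
  have hΔ' : (0 : ℝ) ≤ (G.maxDegree : ℝ) - 1 := sub_nonneg.2 (by exact_mod_cast hΔ)
  have hε : 0 ≤ 1 - δ ^ 2 := sub_nonneg.2 (pow_le_one₀ hδ0.le hδ1)
  have hmax := maxNorm_nonneg (μ - ν)
  refine Real.iSup_le (fun e => ?_) (by positivity)
  obtain ⟨P, N, hP, hN, hPN, htr⟩ := exists_tensorProd_sub
    (A := fun m : OtherLegs G e.fst (outLeg e) => μ (inDart G e.fst m.1))
    (B := fun m : OtherLegs G e.fst (outLeg e) => ν (inDart G e.fst m.1))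
    (fun _ => (hμ _).1) (fun _ => (hν _).1) (fun _ => (hμ _).2) (fun _ => (hν _).2)
  set σ := sval (ψ.tensor e.fst) 0 with hσ
  have hσ0 : 0 < σ := by
    obtain ⟨c, hc, h⟩ := exists_pos_le_sval (hψ.1 e.fst)
    have : Nonempty (Fin D) := ⟨⟨0, hD⟩⟩
    exact hc.trans_le (h 0 Fintype.card_pos)
  have hmain := traceNorm_normalized_contract_sub_le hD (s := σ ^ 2) (c := (δ * σ) ^ 2)
    (by positivity)
    (posSemidef_conjTranspose_mul_self_sub (ψ.tensor e.fst) (by positivity) (hψ.2 e.fst))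
    (posSemidef_sub_conjTranspose_mul_self (ψ.tensor e.fst)) (outLeg e)
    (posSemidef_environment hμ e) (posSemidef_environment hν e) (trace_environment hμ e)
    (trace_environment hν e) hP hN hPN
  rw [← unnormalizedMap_eq_contract, ← unnormalizedMap_eq_contract, htr] at hmain
  have hcard : (Fintype.card (OtherLegs G e.fst (outLeg e)) : ℝ) ≤ (G.maxDegree : ℝ) - 1 := by
    have h1 : Fintype.card (OtherLegs G e.fst (outLeg e)) < Fintype.card (G.neighborSet e.fst) :=
      Fintype.card_subtype_lt (x := outLeg e) (by simp)
    rw [G.card_neighborSet_eq_degree] at h1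
    have h2 := h1.trans_le (G.degree_le_maxDegree e.fst)
    rw [le_sub_iff_add_le]
    exact_mod_cast h2
  have hsum : ∑ m : OtherLegs G e.fst (outLeg e),
      traceNorm (μ (inDart G e.fst m.1) - ν (inDart G e.fst m.1)) ≤
        ((G.maxDegree : ℝ) - 1) * maxNorm (μ - ν) := by
    refine (Finset.sum_le_card_nsmul _ _ (maxNorm (μ - ν)) fun m _ =>
      traceNorm_le_maxNorm (μ - ν) _).trans ?_
    rw [nsmul_eq_mul, Finset.card_univ]
    exact mul_le_mul_of_nonneg_right hcard hmax
  have hconst : 2 * (σ ^ 2 - (δ * σ) ^ 2) / (δ * σ) ^ 2 = 2 * (1 - δ ^ 2) / δ ^ 2 := by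
    field_simp
  rw [hconst] at hmain
  refine hmain.trans ((mul_le_mul_of_nonneg_left hsum (by positivity)).trans_eq ?_)
  ring

theorem maxNorm_iterate_sub_le {ψ : PEPS G D d} {q : ℝ} (hq : 0 ≤ q)
    (hmaps : Set.MapsTo ψ.bpMap (densityMessages G D) (densityMessages G D))
    (hcontr : ∀ μ ∈ densityMessages G D, ∀ ν ∈ densityMessages G D,
      maxNorm (ψ.bpMap μ - ψ.bpMap ν) ≤ q * maxNorm (μ - ν))
    {μs μ₀ : Messages G D} (hμs : μs ∈ densityMessages G D) (hfix : ψ.bpMap μs = μs)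
    (hμ₀ : μ₀ ∈ densityMessages G D) (t : ℕ) :
    maxNorm (ψ.bpMap^[t] μ₀ - μs) ≤ q ^ t * maxNorm (μ₀ - μs) := by
  induction t with
  | zero => simp
  | succ t ih =>
    have h := hcontr _ (hmaps.iterate t hμ₀) _ hμs
    rw [hfix, ← Function.iterate_succ_apply' ψ.bpMap] at h
    refine h.trans ((mul_le_mul_of_nonneg_left ih hq).trans_eq ?_)
    ring

end PEPS

end BPMap

/-! ### The number of steps -/

/-- The step count for accuracy `η`: `2 r ^ t ≤ η` once `t log (1 / r) ≥ 2 log (1 / η)`, since then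
`r ^ t ≤ η ^ 2 ≤ η / 2`. -/
theorem pow_mul_two_le_of_log_le {r η : ℝ} (hr0 : 0 < r) (hr1 : r < 1) (hη0 : 0 < η)
    (hη : η ≤ 1 / 2) {t : ℕ} (ht : 2 * (Real.log (1 / η) / Real.log (1 / r)) ≤ t) :
    r ^ t * 2 ≤ η := by
  have hlog : Real.log r < 0 := Real.log_neg hr0 hr1
  rw [one_div, one_div, Real.log_inv, Real.log_inv, neg_div_neg_eq, mul_div_assoc',
    div_le_iff_of_neg hlog] at ht
  have h1 : r ^ t ≤ η ^ 2 := by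
    rw [← Real.log_le_log_iff (by positivity) (by positivity), Real.log_pow, Real.log_pow]
    exact_mod_cast ht
  nlinarith

end TNBP

/-! ### Fixed points of the message-passing map -/

theorem theorem1 :
    -- an absolute constant for the number of steps
    ∃ C : ℝ, 0 < C ∧
    ∀ (V : Type*) [Fintype V] [DecidableEq V] (G : SimpleGraph V) [DecidableRel G.Adj]
      (D d : ℕ) (_ : 0 < D) (ψ : TNBP.PEPS G D d),
      -- (i) for an injective PEPS the map `F` is well defined on `K_G` and has a fixed point
      (ψ.IsInjective →
        (∀ μ ∈ TNBP.densityMessages G D, ∀ e, 0 < (ψ.unnormalizedMap μ e).trace.re) ∧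
        Set.MapsTo ψ.bpMap (TNBP.densityMessages G D) (TNBP.densityMessages G D) ∧
        ∃ μ ∈ TNBP.densityMessages G D, ψ.bpMap μ = μ) ∧
      ∀ δ ε εstar q : ℝ, 0 < δ → δ ≤ 1 → ψ.IsDeltaInjective δ →
        ε = 1 - δ ^ 2 →
        εstar = 1 / (2 * (G.maxDegree : ℝ) - 1) →
        q = 2 * ((G.maxDegree : ℝ) - 1) * ε / (1 - ε) →
        -- the trace lower bound
        (ψ.IsNormalized → ∀ μ ∈ TNBP.densityMessages G D, ∀ e,
          (D : ℝ) * δ ^ 2 ≤ (ψ.unnormalizedMap μ e).trace.re) ∧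
        -- (ii) contraction, uniqueness and convergence
        (ε < εstar →
          (0 ≤ q ∧ q < 1 ∧
            ∀ μ ∈ TNBP.densityMessages G D, ∀ ν ∈ TNBP.densityMessages G D,
              TNBP.maxNorm (ψ.bpMap μ - ψ.bpMap ν) ≤ q * TNBP.maxNorm (μ - ν)) ∧
          ∃ μstar ∈ TNBP.densityMessages G D, ψ.bpMap μstar = μstar ∧
            (∀ ν ∈ TNBP.densityMessages G D, ψ.bpMap ν = ν → ν = μstar) ∧
            ∀ μ₀ ∈ TNBP.densityMessages G D,
              (∀ t : ℕ, TNBP.maxNorm (ψ.bpMap^[t] μ₀ - μstar)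
                ≤ q ^ t * TNBP.maxNorm (μ₀ - μstar)) ∧
              (ε = 0 → ∀ t : ℕ, 1 ≤ t → ψ.bpMap^[t] μ₀ = μstar) ∧
              (0 < ε → ∀ η : ℝ, 0 < η → η ≤ 1 / 2 → ∀ t : ℕ,
                C * (Real.log (1 / η) / Real.log (εstar / ε)) ≤ t →
                TNBP.maxNorm (ψ.bpMap^[t] μ₀ - μstar) ≤ η)) := by
  refine ⟨2, two_pos, fun V _ _ G _ D d hD ψ => ⟨fun hψ => ⟨fun μ hμ e =>
    TNBP.PEPS.trace_unnormalizedMap_pos hD hψ hμ e, TNBP.PEPS.mapsTo_bpMap hD hψ,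
    TNBP.PEPS.exists_fixedPoint_bpMap hD hψ⟩, ?_⟩⟩
  intro δ ε εstar q hδ0 hδ1 hψ hε hεstar hq
  refine ⟨fun hnorm μ hμ e => ?_, fun hlt => ?_⟩
  · have h := ψ.le_trace_unnormalizedMap hμ e hδ0.le fun i hi => by
      simpa [hnorm e.fst] using hψ.2 e.fst i hi
    rwa [mul_comm] at h
  have hδsq : 0 < δ ^ 2 := pow_pos hδ0 2
  have hε0 : 0 ≤ ε := by
    rw [hε]
    exact sub_nonneg.2 (pow_le_one₀ hδ0.le hδ1)
  have hε1 : 1 - ε = δ ^ 2 := by rw [hε]; ring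
  -- `ε < ε_*` excludes graphs without edges, for which `ε_*` would be negative
  have hk : 0 < 2 * (G.maxDegree : ℝ) - 1 := by
    have := hε0.trans_lt hlt
    rwa [hεstar, one_div, inv_pos] at this
  have hΔ : 1 ≤ G.maxDegree := by
    by_contra h0
    rw [Nat.lt_one_iff.1 (not_le.1 h0)] at hk
    norm_num at hk
  have hΔ' : (0 : ℝ) ≤ (G.maxDegree : ℝ) - 1 := sub_nonneg.2 (by exact_mod_cast hΔ)
  have hr : ε * (2 * (G.maxDegree : ℝ) - 1) < 1 := by rwa [hεstar, lt_div_iff₀ hk] at hlt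
  have hq0 : 0 ≤ q := by
    rw [hq, hε1]
    positivity
  -- the right-hand side is `ε / ε_*`
  have hq1 : q ≤ ε * (2 * (G.maxDegree : ℝ) - 1) := by
    rw [hq, div_le_iff₀ (hε1 ▸ hδsq)]
    nlinarith
  have hmaps := TNBP.PEPS.mapsTo_bpMap hD hψ.1
  have hcontr : ∀ μ ∈ TNBP.densityMessages G D, ∀ ν ∈ TNBP.densityMessages G D,
      TNBP.maxNorm (ψ.bpMap μ - ψ.bpMap ν) ≤ q * TNBP.maxNorm (μ - ν) := by
    intro μ hμ ν hν
    rw [hq, hε1, hε]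
    exact TNBP.PEPS.maxNorm_bpMap_sub_le hD hδ0 hδ1 hψ hΔ hμ hν
  obtain ⟨μs, hμs, hfix⟩ := TNBP.PEPS.exists_fixedPoint_bpMap hD hψ.1
  refine ⟨⟨hq0, hq1.trans_lt hr, hcontr⟩, μs, hμs, hfix, fun ν hν hνfix => ?_, fun μ₀ hμ₀ => ?_⟩
  · refine TNBP.eq_of_maxNorm_sub_le_zero hν hμs ?_
    have h := hcontr ν hν μs hμs
    rw [hνfix, hfix] at h
    nlinarith
  have hiter := TNBP.PEPS.maxNorm_iterate_sub_le hq0 hmaps hcontr hμs hfix hμ₀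
  refine ⟨hiter, fun hεz t ht => ?_, fun hεpos η hη0 hη t ht => ?_⟩
  · refine TNBP.eq_of_maxNorm_sub_le_zero (hmaps.iterate t hμ₀) hμs ((hiter t).trans_eq ?_)
    rw [hq, hεz, mul_zero, zero_div, zero_pow (by omega), zero_mul]
  · have hrpos : 0 < ε * (2 * (G.maxDegree : ℝ) - 1) := mul_pos hεpos hk
    have hεr : εstar / ε = 1 / (ε * (2 * (G.maxDegree : ℝ) - 1)) := by
      rw [hεstar]
      field_simp
    rw [hεr] at ht
    refine (hiter t).trans (le_trans ?_ (TNBP.pow_mul_two_le_of_log_le hrpos hr hη0 hη ht))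
    exact mul_le_mul (pow_le_pow_left₀ hq0 hq1 t) (TNBP.maxNorm_sub_le_two hμ₀ hμs)
      (TNBP.maxNorm_nonneg _) (by positivity)
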